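/- Let $n\ge 3$, let $\boldsymbol y\in\mathbb R^n$ be nonzero, $a=|\boldsymbol y|$, $\hat{\boldsymbol y}=\boldsymbol y/a$, and let $\varepsilon>0$. For $\boldsymbol x\in\mathbb R^n$ let $$\gamma=\gamma(\boldsymbol x+i\boldsymbol y)=\sqrt{|\boldsymbol x|^2-a^2+2i\,\boldsymbol x\cdot\boldsymbol y}=p+iq,\qquad p\ge 0,$$ be the branch of the square root with nonnegative real part, let $\omega_m=2\pi^{m/2}/\Gamma(m/2)$, and let $$\phi(\boldsymbol x+i\boldsymbol y)=\frac{1}{\omega_n}\,\frac{\gamma^{2-n}}{2-n},\qquad \phi_\varepsilon=\theta(p-\varepsilon)\,\phi,$$ where $\theta$ is the unit step function. Let $\tilde\delta_\varepsilon=\Delta\phi_\varepsilon$, the Laplacian with respect to $\boldsymbol x$ being taken in the sense of distributions, i.e. $\langle\tilde\delta_\varepsilon,f\rangle=\int_{\mathbb R^n}\phi_\varepsilon\,\Delta f\,d\boldsymbol x$ for every compactly supported $f:\mathbb R^n\to\mathbb C$ of class $C^2$. Then: 1. The level set $E_\varepsilon=\{\boldsymbol x\mid p=\varepsilon\}$ is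 the oblate spheroid $$\frac{\rho^2}{a^2+\varepsilon^2}+\frac{\zeta^2}{\varepsilon^2}=1,\qquad \zeta=\boldsymbol x\cdot\hat{\boldsymbol y},\quad \rho^2=|\boldsymbol x|^2-\zeta^2,$$ and $\tilde\delta_\varepsilon$ is supported on $E_\varepsilon$, i.e. $\operatorname{supp}\tilde\delta_\varepsilon\subseteq E_\varepsilon$. 2. For every compactly supported $f:\mathbb R^n\to\mathbb C$ of class $C^2$, let $$\bar f^\sharp(p,q)=\int_{S^{n-2}}f(\rho\,\boldsymbol\sigma+\zeta\,\hat{\boldsymbol y})\,d\boldsymbol\sigma,\qquad \rho=\frac{\sqrt{a^2+p^2}\,\sqrt{a^2-q^2}}{a},\quad \zeta=\frac{pq}{a},$$ be the mean over the unit sphere $S^{n-2}$ of the hyperplane orthogonal to $\boldsymbol y$ ($d\boldsymbol\sigma$ is the surface measure normalized to total mass $1$), and let $\bar f^\sharp_p=\partial_p\bar f^\sharp$. Then $\bar f^\sharp_p(\varepsilon,q)$ exists for all $q\in[-a,a]$, the integrand below is integrable on $[-a,a]$, and $$\langle\tilde\delta_\varepsilon,f\rangle=I_\varepsilon(\bar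 f^\sharp):=\frac{(a^2+\varepsilon^2)^{\nu+1}}{a^{n-2}A_n}\int_{-a}^{a}\frac{F^\sharp(\varepsilon+iq)}{(\varepsilon+iq)^{n-1}}\,dq,\qquad \nu=\frac{n-3}{2},\quad A_n=\frac{\omega_n}{\omega_{n-1}},$$ where $$F^\sharp(p+iq)=(a^2-q^2)^\nu\left[\bar f^\sharp(p,q)+\frac{(p+iq)\,\bar f^\sharp_p(p,q)}{n-2}\right].$$ -/

import Mathlib

open MeasureTheory Real
open scoped Distributions InnerProductSpace

noncomputable section

namespace ComplexDistance

/-- The space `ℝⁿ` with its Euclidean structure. -/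
abbrev Space (n : ℕ) : Type := EuclideanSpace ℝ (Fin n)

/-- The complex length `γ(x + iy) = √((x + iy)²) = √(r² - a² + 2i x·y)`, `r = ‖x‖`, `a = ‖y‖`,
with the branch of the square root that has nonnegative real part. -/
def complexLength {n : ℕ} (x y : Space n) : ℂ :=
  (((‖x‖ ^ 2 - ‖y‖ ^ 2 : ℝ) : ℂ) + 2 * Complex.I * ((⟪x, y⟫_ℝ : ℝ) : ℂ)) ^ (1 / 2 : ℂ)

/-- The area `ω_n = 2 π^{n/2} / Γ(n/2)` of the unit sphere in `ℝⁿ`. -/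
def sphereArea (n : ℕ) : ℝ :=
  2 * π ^ ((n : ℝ) / 2) / Real.Gamma ((n : ℝ) / 2)

/-- The ratio `A_n = ω_n / ω_{n-1}`. -/
def areaRatio (n : ℕ) : ℝ :=
  sphereArea n / sphereArea (n - 1)

/-- The holomorphic potential `φ(x + iy) = γ^{2-n} / ((2 - n) ω_n)`. -/
def potential {n : ℕ} (x y : Space n) : ℂ :=
  (1 / (sphereArea n : ℂ)) * (complexLength x y ^ (2 - (n : ℤ)) / (2 - (n : ℂ)))

/-- The unit step function (its value at `0` is irrelevant here). -/
def heaviside (ξ : ℝ) : ℝ :=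
  if 0 < ξ then 1 else 0

/-- The regularized potential `φ_ε = θ(p - ε) φ`, where `p = Re γ`. -/
def regPotential {n : ℕ} (y : Space n) (ε : ℝ) (x : Space n) : ℂ :=
  (heaviside ((complexLength x y).re - ε) : ℂ) * potential x y

/-- The surface `E_ε = {x | p = ε}`. -/
def spheroid {n : ℕ} (y : Space n) (ε : ℝ) : Set (Space n) :=
  {x | (complexLength x y).re = ε}

/-- The distribution `f ↦ ∫ u(x) f(x) dx` given by a locally integrable function `u`, acting on
complex-valued, compactly supported test functions. -/
def functionDistribution {n : ℕ} (u : Space n → ℂ) :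
    𝓓^{0}((⊤ : TopologicalSpace.Opens (Space n)), ℂ) →L[ℂ] ℂ :=
  TestFunction.integralAgainstBilinCLM (ContinuousLinearMap.mul ℂ ℂ) volume u

/-- The Laplacian `Δ T` of a distribution `T` of order `0`, as a distribution acting on
compactly supported functions of class `C²`: `⟨Δ T, f⟩ = ⟨T, Δ f⟩` with `Δ f = ∑ᵢ ∂ᵢ ∂ᵢ f`. -/
def distLaplacian {n : ℕ} (T : 𝓓^{0}((⊤ : TopologicalSpace.Opens (Space n)), ℂ) →L[ℂ] ℂ) :
    𝓓^{2}((⊤ : TopologicalSpace.Opens (Space n)), ℂ) →L[ℂ] ℂ :=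
  T ∘L ∑ i : Fin n,
    (TestFunction.lineDerivCLM ℂ (EuclideanSpace.basisFun (Fin n) ℝ i) :
        𝓓^{1}((⊤ : TopologicalSpace.Opens (Space n)), ℂ) →L[ℂ]
          𝓓^{0}((⊤ : TopologicalSpace.Opens (Space n)), ℂ)) ∘L
      (TestFunction.lineDerivCLM ℂ (EuclideanSpace.basisFun (Fin n) ℝ i) :
        𝓓^{2}((⊤ : TopologicalSpace.Opens (Space n)), ℂ) →L[ℂ]
          𝓓^{1}((⊤ : TopologicalSpace.Opens (Space n)), ℂ))

/-- The regularized source distribution `δ̃_ε = Δ φ_ε`. -/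
def regSource {n : ℕ} (y : Space n) (ε : ℝ) :
    𝓓^{2}((⊤ : TopologicalSpace.Opens (Space n)), ℂ) →L[ℂ] ℂ :=
  distLaplacian (functionDistribution (regPotential y ε))

/-- The hyperplane through the origin orthogonal to `y`. -/
abbrev hyperplane {n : ℕ} (y : Space n) : Submodule ℝ (Space n) :=
  (Submodule.span ℝ {y})ᗮ

/-- The surface measure on the unit sphere `S^{n-2}` of the hyperplane orthogonal to `y`
(not yet normalized), from the Lebesgue measure of the hyperplane. -/
def sphereMeasure {n : ℕ} (y : Space n) :
    Measure (Metric.sphere (0 : hyperplane y) 1) :=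
  ((stdOrthonormalBasis ℝ (hyperplane y)).toBasis.addHaar).toSphere

/-- The mean `f̄(ρ, ζ)` of `f(ρ σ + ζ ŷ)` over `σ ∈ S^{n-2}`, `ŷ = y / ‖y‖`. -/
def cylMean {n : ℕ} (y : Space n) (f : Space n → ℂ) (ρ ζ : ℝ) : ℂ :=
  ⨍ σ, f (ρ • ((σ : hyperplane y) : Space n) + ζ • (‖y‖⁻¹ • y)) ∂(sphereMeasure y)

/-- The mean `f̄♯(p, q) = f̄(ρ, ζ)` in oblate spheroidal coordinates, with
`a ρ = √(a² + p²) √(a² - q²)` and `a ζ = p q`, where `a = ‖y‖`. -/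
def sharpMean {n : ℕ} (y : Space n) (f : Space n → ℂ) (p q : ℝ) : ℂ :=
  cylMean y f (√(‖y‖ ^ 2 + p ^ 2) * √(‖y‖ ^ 2 - q ^ 2) / ‖y‖) (p * q / ‖y‖)

/-- For a function `g = g(p, q)`, the function
`F(p + iq) = (a² - q²)^ν [g + γ g_p / (n - 2)]` with `ν = (n - 3)/2` and `γ = p + iq`. -/
def sourceDensity (n : ℕ) (a : ℝ) (g : ℝ → ℝ → ℂ) (p q : ℝ) : ℂ :=
  (((a ^ 2 - q ^ 2) ^ (((n : ℝ) - 3) / 2) : ℝ) : ℂ) *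
    (g p q + ((p : ℂ) + Complex.I * (q : ℂ)) * deriv (fun s : ℝ => g s q) p / ((n : ℂ) - 2))

/-- The functional
`I_ε(g) = (a² + ε²)^{ν+1} / (a^{n-2} A_n) ∫_{-a}^{a} F(ε + iq) / (ε + iq)^{n-1} dq`. -/
def sourceFunctional (n : ℕ) (a ε : ℝ) (g : ℝ → ℝ → ℂ) : ℂ :=
  (((a ^ 2 + ε ^ 2) ^ (((n : ℝ) - 3) / 2 + 1) / (a ^ (n - 2) * areaRatio n) : ℝ) : ℂ) *
    ∫ q in (-a)..a, sourceDensity n a g ε q / ((ε : ℂ) + Complex.I * (q : ℂ)) ^ (n - 1)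

end ComplexDistance

end

/-! ### The complex length `γ`: its branch, its level sets, its derivatives. -/

noncomputable section

namespace ComplexDistance

variable {n : ℕ}

/-! Where `p > 0`, `γ² = (x + iy)·(x + iy)` gives `dγ = γ⁻¹⟨x + iy, ·⟩`, so `φ₀ = γ^{2-n}/(2-n)` has
gradient `γ^{-n}(x + iy)`, whose divergence `nγ^{-n} - nγ^{-n-2}γ²` vanishes. Thus `φ` is harmonic
off the focal disk, and `Δφ_ε` comes only from the jump across `E_ε`.

To avoid surface integrals, the step is replaced by a smooth `χ(p)` vanishing for `p ≤ ε`. The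
compactly supported field `χφ₀∇f - fχ∇φ₀` has integral of divergence zero, hence `∫ χφ₀Δf = ∫
χ'(p)(f∇p·∇φ₀ - φ₀∇p·∇f)` (`sum_fderiv_flux`, `integral_cutoffPotential_mul_laplacian`).

The right side is computed in oblate spheroidal coordinates `(p, q, σ)`, reached through cylindrical
ones (`integral_eq_integral_cylPoint`, `integral_spheroidalCoord`). There `∇p = (a² + p²)/(p² + q²)
∂ₚ`, and the product of Jacobian, `ρ^{n-2}` and this factor loses its `p² + q²`
(`jacobian_mul_pow`). Integrating over `σ` and `q` leaves `∫ χ'(p) ω_n I_p dp`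
(`integral_smoothDensity`).

Now let `χ` tend to the step. The left side converges by dominated convergence, since `|γ| ≥ p ≥ ε`
where `χ ≠ 0`; on the right `χ'` is an approximate identity at `ε` and `I_p` is continuous for `p >
0`. This gives `I_ε` (`integral_regPotential_mul_coordLaplacian`). The support claim follows because
`I_ε` sees only `f` and `∇f` on `E_ε`. -/

theorem complexLength_sq (x y : Space n) :
    complexLength x y ^ 2 =
      ((‖x‖ ^ 2 - ‖y‖ ^ 2 : ℝ) : ℂ) + 2 * Complex.I * ((⟪x, y⟫_ℝ : ℝ) : ℂ) := by
  have := Complex.cpow_ofNat_inv_pow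
    (((‖x‖ ^ 2 - ‖y‖ ^ 2 : ℝ) : ℂ) + 2 * Complex.I * ((⟪x, y⟫_ℝ : ℝ) : ℂ)) 2
  rw [complexLength, one_div]
  exact this

theorem complexLength_re_nonneg (x y : Space n) : 0 ≤ (complexLength x y).re := by
  rw [complexLength]
  set w : ℂ := ((‖x‖ ^ 2 - ‖y‖ ^ 2 : ℝ) : ℂ) + 2 * Complex.I * ((⟪x, y⟫_ℝ : ℝ) : ℂ)
  by_cases hw : w = 0
  · rw [hw, Complex.zero_cpow (by norm_num)]; simp
  rw [Complex.cpow_def_of_ne_zero hw, Complex.exp_re]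
  refine mul_nonneg (Real.exp_nonneg _) (Real.cos_nonneg_of_mem_Icc ?_)
  have h : (Complex.log w * (1 / 2)).im = w.arg / 2 := by
    rw [Complex.mul_im, Complex.log_im]
    norm_num; ring
  rw [h]
  constructor <;> linarith [Complex.neg_pi_lt_arg w, Complex.arg_le_pi w]

theorem complexLength_sq_sub (x y : Space n) :
    (complexLength x y).re ^ 2 - (complexLength x y).im ^ 2 = ‖x‖ ^ 2 - ‖y‖ ^ 2 := by
  have h := congrArg Complex.re (complexLength_sq x y)
  simp [pow_two] at h
  simp only [pow_two]
  exact h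

theorem complexLength_re_mul_im (x y : Space n) :
    (complexLength x y).re * (complexLength x y).im = ⟪x, y⟫_ℝ := by
  have h := congrArg Complex.im (complexLength_sq x y)
  simp [pow_two] at h
  linarith

/-- The other root `-z` has negative real part. This fixes the branch, both when identifying `γ` and
when showing that spheroidal coordinates are injective. -/
theorem eq_of_sq_eq_of_re_pos {z w : ℂ} (hz : 0 < z.re) (hw : 0 ≤ w.re) (h : w ^ 2 = z ^ 2) :
    w = z := by
  rcases sq_eq_sq_iff_eq_or_eq_neg.mp h with h | h
  · exact h
  · rw [h] at hw; simp at hw; linarith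

theorem complexLength_eq {x y : Space n} {p q : ℝ} (hp : 0 < p)
    (h1 : p ^ 2 - q ^ 2 = ‖x‖ ^ 2 - ‖y‖ ^ 2) (h2 : p * q = ⟪x, y⟫_ℝ) :
    complexLength x y = (p : ℂ) + Complex.I * (q : ℂ) := by
  refine eq_of_sq_eq_of_re_pos (by simpa using hp) (complexLength_re_nonneg x y) ?_
  rw [complexLength_sq, ← h1, ← h2]
  push_cast
  linear_combination (- (q : ℂ) ^ 2) * Complex.I_sq

/-- `γ` jumps across the focal disk, but only in its imaginary part: `p = √((|γ²| + Re γ²)/2)` is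
continuous everywhere. -/
theorem continuous_complexLength_re (y : Space n) :
    Continuous fun x : Space n => (complexLength x y).re := by
  have h : (fun x : Space n => (complexLength x y).re) = fun x =>
      √((‖((‖x‖ ^ 2 - ‖y‖ ^ 2 : ℝ) : ℂ) + 2 * Complex.I * ((⟪x, y⟫_ℝ : ℝ) : ℂ)‖
        + (‖x‖ ^ 2 - ‖y‖ ^ 2)) / 2) := by
    funext x
    rw [← complexLength_sq, ← complexLength_sq_sub, norm_pow, Complex.sq_norm, Complex.normSq_apply]
    rw [← Real.sqrt_sq (complexLength_re_nonneg x y)]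
    congr 1
    rw [Real.sqrt_sq (complexLength_re_nonneg x y)]
    ring
  rw [h]
  fun_prop

theorem spheroid_eq {y : Space n} (hy : y ≠ 0) {ε : ℝ} (hε : 0 < ε) :
    spheroid y ε =
      {x | (‖x‖ ^ 2 - (⟪x, y⟫_ℝ / ‖y‖) ^ 2) / (‖y‖ ^ 2 + ε ^ 2)
          + (⟪x, y⟫_ℝ / ‖y‖) ^ 2 / ε ^ 2 = 1} := by
  have ha : 0 < ‖y‖ := norm_pos_iff.mpr hy
  ext x
  simp only [spheroid, Set.mem_ofPred_eq]
  have hs : 0 < ‖y‖ ^ 2 + ε ^ 2 := by positivity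
  constructor
  · intro h
    have h1 := complexLength_sq_sub x y
    have h2 := complexLength_re_mul_im x y
    rw [h] at h1 h2
    rw [← h2]
    field_simp
    linear_combination (-‖y‖ ^ 2) * h1
  · intro h
    have key : ‖y‖ ^ 2 * ε ^ 2 * (‖x‖ ^ 2) + ⟪x, y⟫_ℝ ^ 2 * ‖y‖ ^ 2
        = ‖y‖ ^ 2 * ε ^ 2 * (‖y‖ ^ 2 + ε ^ 2) := by
      field_simp at h
      linear_combination h
    have h3 : ε ^ 2 * (‖x‖ ^ 2) + ⟪x, y⟫_ℝ ^ 2 = ε ^ 2 * (‖y‖ ^ 2 + ε ^ 2) := by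
      have : ‖y‖ ^ 2 ≠ 0 := by positivity
      apply mul_left_cancel₀ this
      linear_combination key
    -- With real part `ε`, the relation `pq = x·y` forces this imaginary part; the spheroid equation
    -- is then the real part of `γ²`.
    rw [complexLength_eq (q := ⟪x, y⟫_ℝ / ε) hε]
    · simp
    · field_simp
      linear_combination -h3
    · field_simp

/-- The real-linear form `v ↦ ⟪x + iy, v⟫`. -/
def complexForm (x y : Space n) : Space n →L[ℝ] ℂ :=
  Complex.ofRealCLM ∘L innerSL ℝ x + Complex.I • Complex.ofRealCLM ∘L innerSL ℝ y

@[simp]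
theorem complexForm_apply (x y v : Space n) :
    complexForm x y v = (⟪x, v⟫_ℝ : ℂ) + Complex.I * (⟪y, v⟫_ℝ : ℂ) := by
  simp [complexForm]

theorem complexLength_ne_zero {x y : Space n} (h : 0 < (complexLength x y).re) :
    complexLength x y ≠ 0 := by
  intro h0; rw [h0] at h; simp at h

/-- A square lies on the closed negative real axis only if its root is purely imaginary, which `p >
0` excludes. -/
theorem mem_slitPlane_of_complexLength_re_pos {x y : Space n} (h : 0 < (complexLength x y).re) :
    ((‖x‖ ^ 2 - ‖y‖ ^ 2 : ℝ) : ℂ) + 2 * Complex.I * ((⟪x, y⟫_ℝ : ℝ) : ℂ) ∈ Complex.slitPlane := by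
  rw [← complexLength_sq, Complex.mem_slitPlane_iff]
  by_cases hq : (complexLength x y).im = 0
  · left
    simp [pow_two, hq]
    positivity
  · right
    simp [pow_two]
    rw [mul_comm (complexLength x y).im, ← two_mul]
    exact mul_ne_zero two_ne_zero (mul_ne_zero h.ne' hq)

theorem contDiffAt_complexLength {x y : Space n} (h : 0 < (complexLength x y).re) {m : ℕ∞} :
    ContDiffAt ℝ m (fun x => complexLength x y) x := by
  unfold complexLength
  have h1 : ContDiffAt ℂ m (fun w : ℂ => w ^ (1 / 2 : ℂ))
      (((‖x‖ ^ 2 - ‖y‖ ^ 2 : ℝ) : ℂ) + 2 * Complex.I * ((⟪x, y⟫_ℝ : ℝ) : ℂ)) := by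
    apply AnalyticAt.contDiffAt
    exact analyticAt_id.cpow analyticAt_const (mem_slitPlane_of_complexLength_re_pos h)
  refine ContDiffAt.comp (g := fun w : ℂ => w ^ (1 / 2 : ℂ)) x (h1.restrict_scalars ℝ) ?_
  have h2 : ContDiff ℝ m (fun x : Space n => (‖x‖ ^ 2 - ‖y‖ ^ 2 : ℝ)) :=
    (contDiff_norm_sq ℝ).sub contDiff_const
  have h3 : ContDiff ℝ m (fun x : Space n => ⟪x, y⟫_ℝ) := contDiff_id.inner ℝ contDiff_const
  exact ((Complex.ofRealCLM.contDiff.comp h2).add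
    (contDiff_const.mul (Complex.ofRealCLM.contDiff.comp h3))).contDiffAt

/-- Implicit differentiation of `γ² = (x + iy)²`: both sides have a unique derivative, so `2γ dγ =
2⟨x + iy, ·⟩`. -/
theorem hasFDerivAt_complexLength {x y : Space n} (h : 0 < (complexLength x y).re) :
    HasFDerivAt (fun x => complexLength x y) ((complexLength x y)⁻¹ • complexForm x y) x := by
  have hd : DifferentiableAt ℝ (fun x => complexLength x y) x :=
    (contDiffAt_complexLength h (m := 1)).differentiableAt (by norm_num)
  have h1 := hd.hasFDerivAt.pow 2
  have h2 : HasFDerivAt (fun x : Space n =>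
      ((‖x‖ ^ 2 - ‖y‖ ^ 2 : ℝ) : ℂ) + 2 * Complex.I * ((⟪x, y⟫_ℝ : ℝ) : ℂ))
      ((2 : ℂ) • complexForm x y) x := by
    have e1 : HasFDerivAt (fun x : Space n => (‖x‖ ^ 2 - ‖y‖ ^ 2 : ℝ)) (2 • innerSL ℝ x) x :=
      (hasStrictFDerivAt_norm_sq x).hasFDerivAt.sub_const _
    have e2 : HasFDerivAt (fun x : Space n => ⟪x, y⟫_ℝ) (innerSL ℝ y) x := by
      have := (innerSL ℝ y).hasFDerivAt (x := x)
      refine this.congr_of_eventuallyEq (Filter.Eventually.of_forall fun x => ?_)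
      simp [real_inner_comm]
    have := (Complex.ofRealCLM.hasFDerivAt.comp x e1).add
      ((Complex.ofRealCLM.hasFDerivAt.comp x e2).const_mul (2 * Complex.I))
    refine this.congr_fderiv ?_
    ext v
    simp
    ring
  have h3 := h1.unique (h2.congr_of_eventuallyEq
    (Filter.Eventually.of_forall fun x => complexLength_sq x y))
  refine hd.hasFDerivAt.congr_fderiv ?_
  ext v
  have h4 := congrArg (fun L => L v) h3
  have h0 := complexLength_ne_zero h
  simp at h4
  simp
  field_simp
  linear_combination (1 / 2) * h4

theorem hasFDerivAt_complexLength_re {x y : Space n} (h : 0 < (complexLength x y).re) :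
    HasFDerivAt (fun x => (complexLength x y).re)
      (Complex.reCLM ∘L ((complexLength x y)⁻¹ • complexForm x y)) x :=
  Complex.reCLM.hasFDerivAt.comp x (hasFDerivAt_complexLength h)

theorem hasFDerivAt_complexLength_zpow {x y : Space n} (h : 0 < (complexLength x y).re) (m : ℤ) :
    HasFDerivAt (fun x => complexLength x y ^ m)
      (((m : ℂ) * complexLength x y ^ (m - 2)) • complexForm x y) x := by
  have h0 := complexLength_ne_zero h
  have h1 := (hasDerivAt_zpow m (complexLength x y) (Or.inl h0)).comp_hasFDerivAt x
    (hasFDerivAt_complexLength h)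
  refine h1.congr_fderiv ?_
  rw [smul_smul]
  congr 1
  rw [show m - 2 = m - 1 - 1 by ring, zpow_sub_one₀ h0 (m - 1)]
  ring

theorem contDiffAt_complexLength_zpow {x y : Space n} (h : 0 < (complexLength x y).re) (k : ℤ)
    {m : ℕ∞} : ContDiffAt ℝ m (fun x => complexLength x y ^ k) x := by
  have h0 := complexLength_ne_zero h
  have h1 : AnalyticAt ℂ (fun z : ℂ => z ^ k) (complexLength x y) := analyticAt_id.zpow h0
  exact (h1.contDiffAt.restrict_scalars ℝ).comp x (contDiffAt_complexLength h)

end ComplexDistance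

/-! ### Green's identity for a smooth cutoff. -/

namespace ComplexDistance

variable {n : ℕ}

/-- The gradient of `x ↦ Re γ(x + iy)`, equal to `(p x + q y) / (p² + q²)`. -/
def gradRe (x y : Space n) : Space n :=
  ((complexLength x y).re ^ 2 + (complexLength x y).im ^ 2)⁻¹ •
    ((complexLength x y).re • x + (complexLength x y).im • y)

theorem inner_gradRe (x y v : Space n) :
    ⟪gradRe x y, v⟫_ℝ = ((complexLength x y)⁻¹ * complexForm x y v).re := by
  rw [gradRe, inner_smul_left, inner_add_left, inner_smul_left, inner_smul_left]
  simp [Complex.inv_re, Complex.inv_im, Complex.normSq_apply, ← pow_two]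
  ring

/-- Divided by `γ`, this is `dγ(∇p)`. It is real, so `∇p ⊥ ∇q`, and it equals `|∇p|²`. -/
theorem complexForm_gradRe {x y : Space n} (h : 0 < (complexLength x y).re) :
    complexForm x y (gradRe x y) =
      (((‖y‖ ^ 2 + (complexLength x y).re ^ 2) /
        ((complexLength x y).re ^ 2 + (complexLength x y).im ^ 2) : ℝ) : ℂ) * complexLength x y := by
  have hs : 0 < (complexLength x y).re ^ 2 + (complexLength x y).im ^ 2 := by positivity
  have h1 := complexLength_sq_sub x y
  have h2 := complexLength_re_mul_im x y
  have h3 : ⟪y, x⟫_ℝ = ⟪x, y⟫_ℝ := real_inner_comm _ _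
  apply Complex.ext
  · simp only [complexForm_apply, gradRe, inner_smul_right, inner_add_right,
      real_inner_self_eq_norm_sq, h3, ← h2]
    simp only [Complex.add_re, Complex.ofReal_re, Complex.mul_re, Complex.I_re, Complex.I_im,
      Complex.ofReal_im]
    field_simp
    linear_combination (-(complexLength x y).re) * h1
  · simp only [complexForm_apply, gradRe, inner_smul_right, inner_add_right,
      real_inner_self_eq_norm_sq, h3, ← h2]
    simp only [Complex.add_im, Complex.ofReal_re, Complex.mul_im, Complex.I_re, Complex.I_im,
      Complex.ofReal_im]
    field_simp
    ring

theorem sum_inner_smul_apply_basis {ι E F : Type*} [Fintype ι] [NormedAddCommGroup E]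
    [InnerProductSpace ℝ E] [NormedAddCommGroup F] [NormedSpace ℝ F]
    (b : OrthonormalBasis ι ℝ E) (L : E →L[ℝ] F) (v : E) :
    ∑ i, ⟪v, b i⟫_ℝ • L (b i) = L v := by
  conv_rhs => rw [← b.sum_repr' v]
  simp [real_inner_comm]

/-- This is `(x + iy)·(x + iy) = γ²` in coordinates, the identity behind the harmonicity of
`γ^{2-n}`. -/
theorem sum_complexForm_sq (x y : Space n) :
    ∑ i, complexForm x y (EuclideanSpace.basisFun (Fin n) ℝ i) ^ 2 = complexLength x y ^ 2 := by
  set b := EuclideanSpace.basisFun (Fin n) ℝ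
  have h : ∀ u v : Space n, ∑ i, (⟪u, b i⟫_ℝ * ⟪v, b i⟫_ℝ) = ⟪u, v⟫_ℝ := by
    intro u v
    rw [← b.sum_inner_mul_inner u v]
    simp [real_inner_comm]
  have h1 : ∀ i, complexForm x y (b i) ^ 2 =
      ((⟪x, b i⟫_ℝ * ⟪x, b i⟫_ℝ - ⟪y, b i⟫_ℝ * ⟪y, b i⟫_ℝ : ℝ) : ℂ)
        + 2 * Complex.I * ((⟪x, b i⟫_ℝ * ⟪y, b i⟫_ℝ : ℝ) : ℂ) := by
    intro i
    rw [complexForm_apply]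
    push_cast
    linear_combination ((⟪y, b i⟫_ℝ : ℂ) ^ 2) * Complex.I_sq
  simp_rw [h1]
  rw [Finset.sum_add_distrib, ← Finset.mul_sum, ← Complex.ofReal_sum, ← Complex.ofReal_sum,
    Finset.sum_sub_distrib, h, h, h, complexLength_sq]
  simp only [real_inner_self_eq_norm_sq]

theorem hasFDerivAt_complexForm (x y e : Space n) :
    HasFDerivAt (fun x => complexForm x y e) (Complex.ofRealCLM ∘L innerSL ℝ e) x := by
  have h := (Complex.ofRealCLM ∘L innerSL ℝ e).hasFDerivAt (x := x) |>.add_const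
    (Complex.I * (⟪y, e⟫_ℝ : ℂ))
  refine h.congr_of_eventuallyEq (Filter.Eventually.of_forall fun x => ?_)
  simp [real_inner_comm]

theorem contDiff_complexForm (y e : Space n) {m : ℕ∞} :
    ContDiff ℝ m (fun x => complexForm x y e) := by
  have h := (Complex.ofRealCLM ∘L innerSL ℝ e).contDiff (n := m) |>.add
    (contDiff_const (c := Complex.I * (⟪y, e⟫_ℝ : ℂ)))
  convert h using 2 with x
  simp [real_inner_comm]

/-- The smooth cutoff `χ(p) γ^{2-n} / (2 - n)` of the (unnormalized) potential. -/
def cutoffPotential (y : Space n) (χ : ℝ → ℝ) (x : Space n) : ℂ :=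
  (χ (complexLength x y).re : ℂ) * (complexLength x y ^ (2 - (n : ℤ)) / (2 - (n : ℂ)))

/-- The components `u ∂ₑ f - f χ(p) ∂ₑ φ` of the flux field of Green's identity. -/
def flux (y : Space n) (χ : ℝ → ℝ) (f : Space n → ℂ) (e x : Space n) : ℂ :=
  cutoffPotential y χ x * fderiv ℝ f x e -
    f x * ((χ (complexLength x y).re : ℂ) * (complexLength x y ^ (-(n : ℤ)) * complexForm x y e))

/-- The density `χ'(p) (f ∇p·∇φ - φ ∇p·∇f)` of the source regularized by a smooth cutoff. -/
def smoothDensity (y : Space n) (χ : ℝ → ℝ) (f : Space n → ℂ) (x : Space n) : ℂ :=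
  ((deriv χ (complexLength x y).re : ℝ) : ℂ) *
    (f x * (complexLength x y ^ (-(n : ℤ)) * complexForm x y (gradRe x y)) -
      complexLength x y ^ (2 - (n : ℤ)) / (2 - (n : ℂ)) * fderiv ℝ f x (gradRe x y))

section Cutoff

variable {y : Space n} {ε : ℝ} {χ : ℝ → ℝ} {f : Space n → ℂ}

theorem eventually_cutoff_eq_zero (hχ0 : ∀ t ≤ ε, χ t = 0)
    {x : Space n} (hx : (complexLength x y).re < ε) :
    ∀ᶠ x' in nhds x, χ (complexLength x' y).re = 0 := by
  have : ∀ᶠ x' in nhds x, (complexLength x' y).re < ε :=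
    (continuous_complexLength_re y).continuousAt.eventually_lt continuousAt_const hx
  filter_upwards [this] with x' hx' using hχ0 _ hx'.le

theorem contDiffAt_ofReal_comp_re {m : ℕ∞} {g : ℝ → ℝ} (hg : ContDiff ℝ m g) {x : Space n}
    (hx : 0 < (complexLength x y).re) :
    ContDiffAt ℝ m (fun x => (g (complexLength x y).re : ℂ)) x := by
  have h1 : ContDiffAt ℝ m (fun x => (complexLength x y).re) x :=
    Complex.reCLM.contDiff.contDiffAt.comp x (contDiffAt_complexLength hx)
  exact Complex.ofRealCLM.contDiff.contDiffAt.comp x (hg.contDiffAt.comp x h1)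

/-- The branch cut lies in `p = 0`, well inside the region where the cutoff vanishes identically. -/
theorem contDiff_cutoffPotential {m : ℕ∞} (hε : 0 < ε) (hχ : ContDiff ℝ m χ)
    (hχ0 : ∀ t ≤ ε, χ t = 0) : ContDiff ℝ m (cutoffPotential y χ) := by
  rw [contDiff_iff_contDiffAt]
  intro x
  rcases lt_or_ge (complexLength x y).re ε with hx | hx
  · refine (contDiffAt_const (c := (0 : ℂ))).congr_of_eventuallyEq ?_
    filter_upwards [eventually_cutoff_eq_zero hχ0 hx] with x' hx'
    simp [cutoffPotential, hx']
  · have hx0 := hε.trans_le hx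
    exact (contDiffAt_ofReal_comp_re hχ hx0).mul
      ((contDiffAt_complexLength_zpow hx0 _).div_const _)

theorem contDiff_flux (hε : 0 < ε) (hχ : ContDiff ℝ 1 χ) (hχ0 : ∀ t ≤ ε, χ t = 0)
    (hf : ContDiff ℝ 2 f) (e : Space n) : ContDiff ℝ 1 (flux y χ f e) := by
  have h1 : ContDiff ℝ 1 (fun x => fderiv ℝ f x e) :=
    (hf.fderiv_right (m := 1) (by norm_num)).clm_apply contDiff_const
  refine ((contDiff_cutoffPotential (m := 1) hε hχ hχ0).mul h1).sub
    ((hf.of_le (by norm_num)).mul ?_)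
  rw [contDiff_iff_contDiffAt]
  intro x
  rcases lt_or_ge (complexLength x y).re ε with hx | hx
  · refine (contDiffAt_const (c := (0 : ℂ))).congr_of_eventuallyEq ?_
    filter_upwards [eventually_cutoff_eq_zero hχ0 hx] with x' hx'
    simp [hx']
  · have hx0 := hε.trans_le hx
    exact (contDiffAt_ofReal_comp_re (m := 1) hχ hx0).mul
      ((contDiffAt_complexLength_zpow (m := 1) hx0 _).mul
        (contDiff_complexForm (m := 1) y e).contDiffAt)

theorem hasCompactSupport_flux (hf : HasCompactSupport f) (e : Space n) :
    HasCompactSupport (flux y χ f e) := by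
  refine hf.mono' ?_
  intro x hx
  by_contra hx'
  apply hx
  have h1 : f x = 0 := image_eq_zero_of_notMem_tsupport hx'
  have h2 : fderiv ℝ f x = 0 := fderiv_of_notMem_tsupport ℝ hx'
  simp [flux, h1, h2]

/-- The flux uses `fχ∇φ₀` instead of `f∇(χφ₀)`, so no second derivative of `χ` arises. The two
`χ∇φ₀·∇f` terms cancel, and `fχΔφ₀` vanishes. -/
theorem sum_fderiv_flux (hn : 3 ≤ n) (hε : 0 < ε) (hχ : ContDiff ℝ 1 χ) (hχ0 : ∀ t ≤ ε, χ t = 0)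
    (hf : ContDiff ℝ 2 f) (x : Space n) :
    ∑ i, fderiv ℝ (flux y χ f (EuclideanSpace.basisFun (Fin n) ℝ i)) x
        (EuclideanSpace.basisFun (Fin n) ℝ i) =
      cutoffPotential y χ x * ∑ i, fderiv ℝ (fun x => fderiv ℝ f x
          (EuclideanSpace.basisFun (Fin n) ℝ i)) x (EuclideanSpace.basisFun (Fin n) ℝ i)
        - smoothDensity y χ f x := by
  set b := EuclideanSpace.basisFun (Fin n) ℝ with hb
  rcases lt_or_ge (complexLength x y).re ε with hx | hx
  · have h0 := eventually_cutoff_eq_zero hχ0 hx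
    have h1 : ∀ e, fderiv ℝ (flux y χ f e) x = 0 := by
      intro e
      have : flux y χ f e =ᶠ[nhds x] fun _ => 0 := by
        filter_upwards [h0] with x' hx'
        simp [flux, cutoffPotential, hx']
      rw [this.fderiv_eq]; simp
    have h2 : deriv χ (complexLength x y).re = 0 := by
      have : χ =ᶠ[nhds (complexLength x y).re] fun _ => 0 := by
        filter_upwards [eventually_lt_nhds hx] with t ht using hχ0 t ht.le
      rw [this.deriv_eq]; simp
    simp [h1, smoothDensity, h2, cutoffPotential, h0.self_of_nhds]
  · have hx0 := hε.trans_le hx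
    have hγ := complexLength_ne_zero hx0
    have hn2 : (2 - (n : ℂ)) ≠ 0 := by
      intro h
      have : (n : ℂ) = (2 : ℕ) := by push_cast; linear_combination -h
      have := Nat.cast_injective this
      omega
    -- The last term is the `e`-part of `fχ div ∇φ₀`; summed over a basis it becomes `nγ² - nγ² =
    -- 0`.
    have key : ∀ e : Space n, fderiv ℝ (flux y χ f e) x e =
        cutoffPotential y χ x * fderiv ℝ (fun x => fderiv ℝ f x e) x e
        - (f x * (((deriv χ (complexLength x y).re : ℝ) : ℂ) * complexLength x y ^ (-(n : ℤ)))) *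
            ((⟪gradRe x y, e⟫_ℝ : ℂ) * complexForm x y e)
        + (((deriv χ (complexLength x y).re : ℝ) : ℂ) * (complexLength x y ^ (2 - (n : ℤ)) / (2 - (n : ℂ))))
            * ((⟪gradRe x y, e⟫_ℝ : ℂ) * fderiv ℝ f x e)
        - f x * χ (complexLength x y).re * complexLength x y ^ (-(n : ℤ) - 2) *
            (complexLength x y ^ 2 * (⟪e, e⟫_ℝ : ℂ) - n * complexForm x y e ^ 2) := by
      intro e
      have d0 : HasFDerivAt (fun x => (χ (complexLength x y).re : ℂ)) _ x :=
        Complex.ofRealCLM.hasFDerivAt.comp x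
          (((hχ.differentiable (by norm_num)) _).hasDerivAt.comp_hasFDerivAt x
            (hasFDerivAt_complexLength_re hx0))
      have d1 := d0.mul ((hasFDerivAt_complexLength_zpow hx0 (2 - (n : ℤ))).mul_const
        ((2 - (n : ℂ))⁻¹))
      have d2 : HasFDerivAt (fun x => fderiv ℝ f x e)
          (fderiv ℝ (fun x => fderiv ℝ f x e) x) x := by
        have h1 : ContDiff ℝ 1 (fun x => fderiv ℝ f x e) :=
          (hf.fderiv_right (m := 1) (by norm_num)).clm_apply contDiff_const
        exact (h1.differentiable (by norm_num) x).hasFDerivAt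
      have d3 : HasFDerivAt f (fderiv ℝ f x) x :=
        (hf.differentiable (by norm_num) x).hasFDerivAt
      have d4 := (d1.mul d2).sub (d3.mul (d0.mul
        ((hasFDerivAt_complexLength_zpow hx0 (-(n : ℤ))).mul (hasFDerivAt_complexForm x y e))))
      have e1 : fderiv ℝ (flux y χ f e) x = _ := d4.fderiv
      rw [e1]
      have z1 : complexLength x y ^ (2 - (n : ℤ) - 2) = complexLength x y ^ (-(n : ℤ)) := by
        congr 1; ring
      have z2 : complexLength x y ^ (-(n : ℤ)) =
          complexLength x y ^ (-(n : ℤ) - 2) * complexLength x y ^ 2 := by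
        rw [← zpow_natCast, ← zpow_add₀ hγ]; congr 1; simp
      rw [inner_gradRe]
      simp only [sub_apply, add_apply,
        smul_apply, ContinuousLinearMap.comp_apply, smul_eq_mul,
        Complex.ofRealCLM_apply, Complex.reCLM_apply, innerSL_apply_apply, cutoffPotential,
        Pi.mul_apply, Complex.ofReal_mul, z1, div_eq_mul_inv]
      have hm : (2 - (n : ℂ))⁻¹ * (2 - (n : ℂ)) = 1 := inv_mul_cancel₀ hn2
      push_cast
      generalize complexLength x y ^ (-(n : ℤ)) = g0 at *
      generalize complexLength x y ^ (-(n : ℤ) - 2) = g1 at *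
      generalize complexLength x y ^ (2 - (n : ℤ)) = g2 at *
      generalize complexForm x y e = z at *
      linear_combination (fderiv ℝ f x e * χ (complexLength x y).re * g0 * z) * hm -
        (f x * χ (complexLength x y).re * (⟪e, e⟫_ℝ : ℂ)) * z2
    simp_rw [key]
    rw [Finset.sum_sub_distrib, Finset.sum_add_distrib, Finset.sum_sub_distrib, ← Finset.mul_sum,
      ← Finset.mul_sum, ← Finset.mul_sum, ← Finset.mul_sum, Finset.sum_sub_distrib,
      ← Finset.mul_sum, ← Finset.mul_sum, sum_complexForm_sq]
    have s1 := sum_inner_smul_apply_basis b (complexForm x y) (gradRe x y)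
    have s2 := sum_inner_smul_apply_basis b (fderiv ℝ f x) (gradRe x y)
    simp only [Complex.real_smul] at s1 s2
    rw [s1, s2, smoothDensity]
    have s3 : ∑ i, (⟪b i, b i⟫_ℝ : ℂ) = n := by simp
    rw [s3]
    ring

theorem integral_fderiv_apply_eq_zero {E : Type*} [NormedAddCommGroup E] [NormedSpace ℝ E]
    [FiniteDimensional ℝ E] [MeasurableSpace E] [BorelSpace E] (μ : Measure E)
    [μ.IsAddHaarMeasure] {g : E → ℂ} (hg : ContDiff ℝ 1 g) (hg' : HasCompactSupport g) (e : E) :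
    ∫ x, fderiv ℝ g x e ∂μ = 0 := by
  have hc : Continuous fun x => fderiv ℝ g x e :=
    (hg.continuous_fderiv (by norm_num)).clm_apply continuous_const
  have hi : Integrable (fun x => fderiv ℝ g x e) μ :=
    hc.integrable_of_hasCompactSupport (hg'.fderiv_apply (𝕜 := ℝ) e)
  -- Integration by parts against the constant `1`, whose derivative is zero.
  have h := integral_mul_fderiv_eq_neg_fderiv_mul_of_integrable (μ := μ) (f := fun _ : E => (1 : ℂ))
    (g := g) (v := e) (by simp) (by simpa using hi)
    (by simpa using hg.continuous.integrable_of_hasCompactSupport hg')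
    (fun x _ => differentiableAt_const _) (fun x _ => hg.differentiable (by norm_num) x)
  simpa using h

/-- The divergence identity expresses the density through functions already known to be continuous,
so its factors need no study near `p = 0`. -/
theorem continuous_smoothDensity (hε : 0 < ε) (hχ : ContDiff ℝ 1 χ) (hχ0 : ∀ t ≤ ε, χ t = 0)
    (hn : 3 ≤ n) (hf : ContDiff ℝ 2 f) : Continuous (smoothDensity y χ f) := by
  have h := fun x => sum_fderiv_flux (y := y) hn hε hχ hχ0 hf x
  have h1 : smoothDensity y χ f = fun x => cutoffPotential y χ x * ∑ i, fderiv ℝ (fun x => fderiv ℝ f x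
          (EuclideanSpace.basisFun (Fin n) ℝ i)) x (EuclideanSpace.basisFun (Fin n) ℝ i) -
      ∑ i, fderiv ℝ (flux y χ f (EuclideanSpace.basisFun (Fin n) ℝ i)) x
        (EuclideanSpace.basisFun (Fin n) ℝ i) := by
    funext x; rw [h x]; ring
  rw [h1]
  refine ((contDiff_cutoffPotential (m := 1) hε hχ hχ0).continuous.mul
    (continuous_finsetSum _ fun i _ => ?_)).sub (continuous_finsetSum _ fun i _ => ?_)
  · have h1 : ContDiff ℝ 1 (fun x => fderiv ℝ f x (EuclideanSpace.basisFun (Fin n) ℝ i)) :=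
      (hf.fderiv_right (m := 1) (by norm_num)).clm_apply contDiff_const
    exact (h1.continuous_fderiv (by norm_num)).clm_apply continuous_const
  · exact ((contDiff_flux hε hχ hχ0 hf _).continuous_fderiv (by norm_num)).clm_apply
      continuous_const

theorem hasCompactSupport_smoothDensity (hf : HasCompactSupport f) :
    HasCompactSupport (smoothDensity y χ f) := by
  refine hf.mono' ?_
  intro x hx
  by_contra hx'
  apply hx
  have h1 : f x = 0 := image_eq_zero_of_notMem_tsupport hx'
  have h2 : fderiv ℝ f x = 0 := fderiv_of_notMem_tsupport ℝ hx'
  simp [smoothDensity, h1, h2]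

theorem integral_cutoffPotential_mul_laplacian (hn : 3 ≤ n) (hε : 0 < ε) (hχ : ContDiff ℝ 1 χ)
    (hχ0 : ∀ t ≤ ε, χ t = 0) (hf : ContDiff ℝ 2 f) (hf' : HasCompactSupport f) :
    ∫ x, cutoffPotential y χ x * ∑ i, fderiv ℝ (fun x => fderiv ℝ f x
          (EuclideanSpace.basisFun (Fin n) ℝ i)) x (EuclideanSpace.basisFun (Fin n) ℝ i) =
      ∫ x, smoothDensity y χ f x := by
  set b := EuclideanSpace.basisFun (Fin n) ℝ
  have hF : ∀ i, Integrable (fun x => fderiv ℝ (flux y χ f (b i)) x (b i)) := fun i =>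
    (((contDiff_flux hε hχ hχ0 hf _).continuous_fderiv (by norm_num)).clm_apply
      continuous_const).integrable_of_hasCompactSupport
        ((hasCompactSupport_flux hf' _).fderiv_apply (𝕜 := ℝ) _)
  have h0 : ∫ x, ∑ i, fderiv ℝ (flux y χ f (b i)) x (b i) = 0 := by
    rw [integral_finsetSum _ fun i _ => hF i]
    exact Finset.sum_eq_zero fun i _ => integral_fderiv_apply_eq_zero _
      (contDiff_flux hε hχ hχ0 hf _) (hasCompactSupport_flux hf' _) _
  have hK : Integrable (smoothDensity y χ f) :=
    (continuous_smoothDensity hε hχ hχ0 hn hf).integrable_of_hasCompactSupport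
      (hasCompactSupport_smoothDensity hf')
  have h1 : (fun x => cutoffPotential y χ x * ∑ i, fderiv ℝ (fun x => fderiv ℝ f x (b i)) x (b i)) =
      fun x => ∑ i, fderiv ℝ (flux y χ f (b i)) x (b i) + smoothDensity y χ f x := by
    funext x
    rw [sum_fderiv_flux hn hε hχ hχ0 hf x]; ring
  rw [h1, integral_add (integrable_finsetSum _ fun i _ => hF i) hK, h0, zero_add]

end Cutoff

end ComplexDistance

/-! ### Polar and cylindrical coordinates. -/

theorem MeasureTheory.integral_volumeIoiPow {F : Type*} [NormedAddCommGroup F] [NormedSpace ℝ F]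
    (m : ℕ) (g : ℝ → F) :
    ∫ r : Set.Ioi (0 : ℝ), g r ∂Measure.volumeIoiPow m = ∫ r in Set.Ioi (0 : ℝ), r ^ m • g r := by
  simp only [Measure.volumeIoiPow, ENNReal.ofReal]
  rw [integral_withDensity_eq_integral_smul,
    integral_subtype_comap measurableSet_Ioi fun a ↦ Real.toNNReal (a ^ m) • g a,
    setIntegral_congr_fun measurableSet_Ioi fun x hx ↦ ?_]
  · rw [NNReal.smul_def, Real.coe_toNNReal _ (pow_nonneg hx.out.le _)]
  · exact (measurable_subtype_coe.pow_const _).real_toNNReal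

/-- Integration in polar coordinates with respect to a Haar measure. -/
theorem MeasureTheory.integral_eq_integral_Ioi_integral_toSphere {E F : Type*}
    [NormedAddCommGroup E] [NormedSpace ℝ E] [FiniteDimensional ℝ E] [Nontrivial E]
    [MeasurableSpace E] [BorelSpace E] [NormedAddCommGroup F] [NormedSpace ℝ F]
    (μ : Measure E) [μ.IsAddHaarMeasure] {h : E → F} (hh : Integrable h μ) :
    ∫ x, h x ∂μ = ∫ r in Set.Ioi (0 : ℝ), r ^ (Module.finrank ℝ E - 1) •
      ∫ σ : Metric.sphere (0 : E) 1, h (r • (σ : E)) ∂μ.toSphere := by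
  set H : Metric.sphere (0 : E) 1 × Set.Ioi (0 : ℝ) → F := fun z => h ((z.2 : ℝ) • (z.1 : E))
  have hH : ∀ x : ({0}ᶜ : Set E), H (homeomorphUnitSphereProd E x) = h x := by
    intro x
    simp only [H]
    congr 1
    have := congrArg Subtype.val ((homeomorphUnitSphereProd E).symm_apply_apply x)
    rwa [homeomorphUnitSphereProd_symm_apply_coe] at this
  have hmp := μ.measurePreserving_homeomorphUnitSphereProd
  have hemb := (homeomorphUnitSphereProd E).measurableEmbedding
  have h1 : ∫ x, h x ∂μ = ∫ x : ({(0)}ᶜ : Set E), h x ∂(μ.comap (↑)) := by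
    rw [integral_subtype_comap (measurableSet_singleton _).compl h, restrict_compl_singleton]
  have h2 : ∫ x : ({(0)}ᶜ : Set E), h x ∂(μ.comap (↑)) =
      ∫ z, H z ∂μ.toSphere.prod (.volumeIoiPow (Module.finrank ℝ E - 1)) := by
    rw [← hmp.integral_comp hemb]
    simp only [hH]
  have h3 : Integrable H (μ.toSphere.prod (.volumeIoiPow (Module.finrank ℝ E - 1))) := by
    rw [← hmp.integrable_comp_emb hemb]
    have : H ∘ homeomorphUnitSphereProd E = h ∘ (↑) := funext hH
    rw [this, ← integrableOn_iff_comap_subtypeVal (measurableSet_singleton _).compl]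
    exact hh.integrableOn
  rw [h1, h2, integral_prod_symm _ h3]
  exact integral_volumeIoiPow _ fun r => ∫ σ : Metric.sphere (0 : E) 1, h (r • (σ : E)) ∂μ.toSphere

namespace ComplexDistance

variable {n : ℕ}

theorem sphereMeasure_eq (y : Space n) :
    sphereMeasure y = (volume : Measure (hyperplane y)).toSphere := by
  rw [sphereMeasure, OrthonormalBasis.addHaar_eq_volume]

instance (y : Space n) : IsFiniteMeasure (sphereMeasure y) := by
  rw [sphereMeasure_eq]; infer_instance

theorem finrank_hyperplane {y : Space n} (hy : y ≠ 0) :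
    Module.finrank ℝ (hyperplane y) = n - 1 := by
  have h := (Submodule.span ℝ {y}).finrank_add_finrank_orthogonal
  rw [finrank_span_singleton hy, finrank_euclideanSpace_fin] at h
  change Module.finrank ℝ (Submodule.span ℝ {y})ᗮ = n - 1
  omega

/-- The point with cylindrical coordinates `ρ, ζ, σ` about the axis spanned by `y`. -/
def cylPoint (y : Space n) (ρ ζ : ℝ) (σ : Metric.sphere (0 : hyperplane y) 1) : Space n :=
  ρ • ((σ : hyperplane y) : Space n) + ζ • (‖y‖⁻¹ • y)

theorem inner_sphere_left (y : Space n) (σ : Metric.sphere (0 : hyperplane y) 1) :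
    ⟪((σ : hyperplane y) : Space n), y⟫_ℝ = 0 :=
  (Submodule.mem_orthogonal_singleton_iff_inner_left).mp (σ : hyperplane y).2

theorem norm_sphere (y : Space n) (σ : Metric.sphere (0 : hyperplane y) 1) :
    ‖((σ : hyperplane y) : Space n)‖ = 1 := by
  exact mem_sphere_zero_iff_norm.mp σ.2

theorem inner_cylPoint {y : Space n} (hy : y ≠ 0) (ρ ζ : ℝ)
    (σ : Metric.sphere (0 : hyperplane y) 1) :
    ⟪cylPoint y ρ ζ σ, y⟫_ℝ = ‖y‖ * ζ := by
  have ha : ‖y‖ ≠ 0 := norm_ne_zero_iff.mpr hy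
  rw [cylPoint, inner_add_left, inner_smul_left, inner_sphere_left, inner_smul_left,
    inner_smul_left, real_inner_self_eq_norm_sq]
  simp
  field_simp

theorem norm_cylPoint_sq {y : Space n} (hy : y ≠ 0) (ρ ζ : ℝ)
    (σ : Metric.sphere (0 : hyperplane y) 1) :
    ‖cylPoint y ρ ζ σ‖ ^ 2 = ρ ^ 2 + ζ ^ 2 := by
  have ha : ‖y‖ ≠ 0 := norm_ne_zero_iff.mpr hy
  rw [cylPoint, norm_add_sq_real, inner_smul_left, inner_smul_right, inner_smul_right,
    inner_sphere_left, norm_smul, norm_smul, norm_smul, norm_sphere]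
  simp [ha]

theorem continuous_cylPoint (y : Space n) :
    Continuous fun z : (ℝ × ℝ) × Metric.sphere (0 : hyperplane y) 1 =>
      cylPoint y z.1.1 z.1.2 z.2 := by
  unfold cylPoint
  fun_prop

theorem continuous_integral_sphere {X : Type*} [TopologicalSpace X] [FirstCountableTopology X]
    [LocallyCompactSpace X]
    (y : Space n) {g : X → Metric.sphere (0 : hyperplane y) 1 → ℂ}
    (hg : Continuous (Function.uncurry g)) :
    Continuous fun t => ∫ σ, g t σ ∂sphereMeasure y := by
  have := continuous_parametric_integral_of_continuous (μ := sphereMeasure y) hg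
    (isCompact_univ (X := Metric.sphere (0 : hyperplane y) 1))
  simpa using this

/-- Integration in cylindrical coordinates about the axis spanned by `y`. -/
theorem integral_eq_integral_cylPoint (hn : 3 ≤ n) {y : Space n} (hy : y ≠ 0) {h : Space n → ℂ}
    (hc : Continuous h) (hs : HasCompactSupport h) :
    ∫ x, h x = ∫ z in Set.Ioi (0 : ℝ) ×ˢ (Set.univ : Set ℝ),
      z.1 ^ (n - 2) • ∫ σ, h (cylPoint y z.1 z.2 σ) ∂sphereMeasure y := by
  have ha : ‖y‖ ≠ 0 := norm_ne_zero_iff.mpr hy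
  have hu : ‖‖y‖⁻¹ • y‖ = 1 := by simp [norm_smul, ha]
  have hfr := finrank_hyperplane hy
  have : Nontrivial (hyperplane y) := Module.nontrivial_of_finrank_pos (R := ℝ) (by omega)
  have hint : Integrable h := hc.integrable_of_hasCompactSupport hs
  -- the isometry `ℝ × yᗮ ≃ ℝⁿ`
  let s := Submodule.span ℝ {‖y‖⁻¹ • y}
  have hsp : s = Submodule.span ℝ {y} :=
    Submodule.span_singleton_smul_eq (IsUnit.mk0 _ (inv_ne_zero ha)) y
  let e1 : ℝ ≃ₗᵢ[ℝ] Submodule.span ℝ {y} :=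
    (LinearIsometryEquiv.toSpanUnitSingleton (‖y‖⁻¹ • y) hu).trans
      (LinearIsometryEquiv.ofEq _ _ hsp)
  have he1 : ∀ t : ℝ, ((e1 t : Submodule.span ℝ {y}) : Space n) = t • (‖y‖⁻¹ • y) := by
    intro t; simp [e1]
  have mp1 : MeasurePreserving (fun z : Submodule.span ℝ {y} × hyperplane y =>
      (z.1 : Space n) + (z.2 : Space n)) := by
    have := ((Submodule.span ℝ {y}).orthogonalDecomposition.symm.measurePreserving).comp
      (WithLp.volume_preserving_toLp (Submodule.span ℝ {y}) (hyperplane y))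
    convert this using 2 with z
    simp
  have mp2 : MeasurePreserving (Prod.map e1 (id : hyperplane y → hyperplane y))
      (volume.prod volume) (volume.prod volume) :=
    e1.measurePreserving.prod (MeasurePreserving.id _)
  have mp : MeasurePreserving (fun z : ℝ × hyperplane y => (z.2 : Space n) + z.1 • (‖y‖⁻¹ • y))
      (volume.prod volume) volume := by
    have he : (fun z : ℝ × hyperplane y => (z.2 : Space n) + z.1 • (‖y‖⁻¹ • y)) =
        (fun z : Submodule.span ℝ {y} × hyperplane y => (z.1 : Space n) + (z.2 : Space n)) ∘
          Prod.map e1 (id : hyperplane y → hyperplane y) := by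
      funext z
      rw [Function.comp_apply, Prod.map_fst, Prod.map_snd, he1, id, add_comm]
    rw [he]
    exact mp1.comp mp2
  have emb : MeasurableEmbedding
      (fun z : ℝ × hyperplane y => (z.2 : Space n) + z.1 • (‖y‖⁻¹ • y)) := by
    let L : ℝ × hyperplane y →ₗ[ℝ] Space n :=
      (hyperplane y).subtype ∘ₗ LinearMap.snd ℝ ℝ (hyperplane y) +
        LinearMap.toSpanSingleton ℝ (Space n) (‖y‖⁻¹ • y) ∘ₗ LinearMap.fst ℝ ℝ (hyperplane y)
    have hL : LinearMap.ker L = ⊥ := by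
      rw [LinearMap.ker_eq_bot']
      rintro ⟨t, v⟩ h0
      have h0' : (v : Space n) + t • (‖y‖⁻¹ • y) = 0 := h0
      have hv : ⟪(v : Space n), y⟫_ℝ = 0 :=
        Submodule.mem_orthogonal_singleton_iff_inner_left.mp v.2
      have h3 := congrArg (fun w => ⟪w, y⟫_ℝ) h0'
      simp only [inner_add_left, hv, inner_smul_left, real_inner_self_eq_norm_sq,
        inner_zero_left] at h3
      have ht : t = 0 := by
        by_contra ht
        simp [ht, ha] at h3
      rw [ht, zero_smul, add_zero] at h0'
      rw [ht, Submodule.coe_eq_zero.mp h0']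
      rfl
    exact (LinearMap.isClosedEmbedding_of_injective hL).measurableEmbedding
  have h1 : ∫ x, h x = ∫ ζ : ℝ, ∫ v : hyperplane y, h ((v : Space n) + ζ • (‖y‖⁻¹ • y)) := by
    rw [← mp.integral_comp emb, integral_prod]
    exact (mp.integrable_comp_emb emb).mpr hint
  have hcl : ∀ ζ : ℝ, Topology.IsClosedEmbedding
      (fun v : hyperplane y => (v : Space n) + ζ • (‖y‖⁻¹ • y)) := fun ζ =>
    (Homeomorph.addRight _).isClosedEmbedding.comp
      (Submodule.closed_of_finiteDimensional (hyperplane y)).isClosedEmbedding_subtypeVal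
  have h2 : ∀ ζ : ℝ, ∫ v : hyperplane y, h ((v : Space n) + ζ • (‖y‖⁻¹ • y)) =
      ∫ ρ in Set.Ioi (0 : ℝ), ρ ^ (n - 2) • ∫ σ, h (cylPoint y ρ ζ σ) ∂sphereMeasure y := by
    intro ζ
    have hi : Integrable fun v : hyperplane y => h ((v : Space n) + ζ • (‖y‖⁻¹ • y)) :=
      (hc.comp (hcl ζ).continuous).integrable_of_hasCompactSupport
        (hs.comp_isClosedEmbedding (hcl ζ))
    rw [integral_eq_integral_Ioi_integral_toSphere _ hi, hfr, sphereMeasure_eq,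
      show n - 1 - 1 = n - 2 by omega]
    simp [cylPoint]
  rw [h1]
  simp_rw [h2]
  -- Joint integrability merges the iterated integrals into one. The support is bounded because
  -- `|x|² = ρ² + ζ²` controls both coordinates.
  have hM : Integrable (fun z : ℝ × ℝ =>
      z.1 ^ (n - 2) • ∫ σ, h (cylPoint y z.1 z.2 σ) ∂sphereMeasure y) := by
    apply Continuous.integrable_of_hasCompactSupport
    · exact (by fun_prop : Continuous fun z : ℝ × ℝ => z.1 ^ (n - 2)).smul
        (continuous_integral_sphere y (g := fun (z : ℝ × ℝ) σ => h (cylPoint y z.1 z.2 σ))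
          (hc.comp (continuous_cylPoint y)))
    · obtain ⟨R, hR⟩ := hs.isCompact.isBounded.subset_closedBall (0 : Space n)
      refine HasCompactSupport.intro
        (isCompact_closedBall (0 : ℝ × ℝ) R) fun z hz => ?_
      have : ∀ σ, h (cylPoint y z.1 z.2 σ) = 0 := by
        intro σ
        apply image_eq_zero_of_notMem_tsupport
        intro hmem
        apply hz
        have h3 := hR hmem
        simp only [Metric.mem_closedBall, dist_zero_right] at h3 ⊢
        have h4 := norm_cylPoint_sq hy z.1 z.2 σ
        have h5 : 0 ≤ ‖cylPoint y z.1 z.2 σ‖ := norm_nonneg _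
        rw [Prod.norm_def, max_le_iff]
        have hR0 := h5.trans h3
        have h6 : ‖cylPoint y z.1 z.2 σ‖ ^ 2 ≤ R ^ 2 := by gcongr
        constructor
        · exact abs_le_of_sq_le_sq (by nlinarith [sq_nonneg z.2]) hR0
        · exact abs_le_of_sq_le_sq (by nlinarith [sq_nonneg z.1]) hR0
      simp [this]
  have hM' : Integrable (fun z : ℝ × ℝ =>
      z.1 ^ (n - 2) • ∫ σ, h (cylPoint y z.1 z.2 σ) ∂sphereMeasure y)
      ((volume.restrict (Set.Ioi (0 : ℝ))).prod (volume.restrict (Set.univ : Set ℝ))) := by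
    rw [Measure.prod_restrict]
    exact hM.integrableOn
  rw [Measure.volume_eq_prod, ← Measure.prod_restrict, integral_prod_symm _ hM',
    Measure.restrict_univ]

end ComplexDistance

/-! ### Oblate spheroidal coordinates in the half-plane `ρ > 0`. -/

namespace ComplexDistance

/-- The cylindrical coordinates `(ρ, ζ)` of the oblate spheroidal coordinates `(p, q)`. -/
def spheroidalCoord (a : ℝ) (z : ℝ × ℝ) : ℝ × ℝ :=
  (√(a ^ 2 + z.1 ^ 2) * √(a ^ 2 - z.2 ^ 2) / a, z.1 * z.2 / a)

/-- The derivative of `spheroidalCoord`. -/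
def fderivSpheroidalCoord (a : ℝ) (z : ℝ × ℝ) : ℝ × ℝ →L[ℝ] ℝ × ℝ :=
  (Matrix.toLin (.finTwoProd ℝ) (.finTwoProd ℝ)
    !![z.1 * √(a ^ 2 - z.2 ^ 2) / (a * √(a ^ 2 + z.1 ^ 2)),
      -(z.2 * √(a ^ 2 + z.1 ^ 2) / (a * √(a ^ 2 - z.2 ^ 2)));
      z.2 / a, z.1 / a]).toContinuousLinearMap

theorem hasFDerivAt_spheroidalCoord {a : ℝ} (ha : 0 < a) {z : ℝ × ℝ} (hz : z.2 ∈ Set.Ioo (-a) a) :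
    HasFDerivAt (spheroidalCoord a) (fderivSpheroidalCoord a z) z := by
  have h1 : 0 < a ^ 2 + z.1 ^ 2 := by positivity
  have h2 : 0 < a ^ 2 - z.2 ^ 2 := by nlinarith [hz.1, hz.2]
  have d1 : HasDerivAt (fun p : ℝ => √(a ^ 2 + p ^ 2)) (z.1 / √(a ^ 2 + z.1 ^ 2)) z.1 := by
    have := (((hasDerivAt_id z.1).pow 2).const_add (a ^ 2)).sqrt h1.ne'
    refine this.congr_deriv ?_
    simp
    field_simp
  have d2 : HasDerivAt (fun q : ℝ => √(a ^ 2 - q ^ 2)) (-(z.2 / √(a ^ 2 - z.2 ^ 2))) z.2 := by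
    have := (((hasDerivAt_id z.2).pow 2).const_sub (a ^ 2)).sqrt h2.ne'
    refine this.congr_deriv ?_
    simp
    field_simp
  have e1 := ((d1.comp_hasFDerivAt z (hasFDerivAt_fst (𝕜 := ℝ) (p := z))).mul
    (d2.comp_hasFDerivAt z (hasFDerivAt_snd (𝕜 := ℝ) (p := z)))).mul_const a⁻¹
  have e2 := ((hasFDerivAt_fst (𝕜 := ℝ) (p := z)).mul hasFDerivAt_snd).mul_const a⁻¹
  unfold fderivSpheroidalCoord
  rw [Matrix.toLin_finTwoProd_toContinuousLinearMap]
  have s1 : 0 < √(a ^ 2 + z.1 ^ 2) := Real.sqrt_pos.mpr h1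
  have s2 : 0 < √(a ^ 2 - z.2 ^ 2) := Real.sqrt_pos.mpr h2
  refine (e1.prodMk e2).congr_fderiv ?_
  ext <;> simp <;> field_simp

/-- Rests on `p²(a² - q²) + q²(a² + p²) = a²(p² + q²)`. -/
theorem det_fderivSpheroidalCoord {a : ℝ} (ha : 0 < a) {z : ℝ × ℝ} (hz : z.2 ∈ Set.Ioo (-a) a) :
    (fderivSpheroidalCoord a z).det =
      (z.1 ^ 2 + z.2 ^ 2) / (√(a ^ 2 + z.1 ^ 2) * √(a ^ 2 - z.2 ^ 2)) := by
  have h1 : 0 < a ^ 2 + z.1 ^ 2 := by positivity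
  have h2 : 0 < a ^ 2 - z.2 ^ 2 := by nlinarith [hz.1, hz.2]
  have s1 : 0 < √(a ^ 2 + z.1 ^ 2) := Real.sqrt_pos.mpr h1
  have s2 : 0 < √(a ^ 2 - z.2 ^ 2) := Real.sqrt_pos.mpr h2
  have t1 := Real.sq_sqrt h1.le
  have t2 := Real.sq_sqrt h2.le
  unfold fderivSpheroidalCoord
  simp only [LinearMap.det_toContinuousLinearMap, LinearMap.det_toLin,
    Matrix.det_fin_two_of]
  field_simp
  rw [t1, t2]
  ring

theorem spheroidalCoord_sq {a : ℝ} (ha : 0 < a) {z : ℝ × ℝ} (hz : z.2 ∈ Set.Icc (-a) a) :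
    (spheroidalCoord a z).1 ^ 2 + (spheroidalCoord a z).2 ^ 2 - a ^ 2 = z.1 ^ 2 - z.2 ^ 2 := by
  have h1 : 0 ≤ a ^ 2 + z.1 ^ 2 := by positivity
  have h2 : 0 ≤ a ^ 2 - z.2 ^ 2 := by nlinarith [hz.1, hz.2]
  simp only [spheroidalCoord]
  rw [div_pow, mul_pow, Real.sq_sqrt h1, Real.sq_sqrt h2]
  field_simp
  ring

/-- `(ρ, ζ)` determines `(p + iq)² = ρ² + ζ² - a² + 2iaζ`, and `p > 0` selects the root. -/
theorem spheroidalCoord_injOn {a : ℝ} (ha : 0 < a) :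
    Set.InjOn (spheroidalCoord a) (Set.Ioi (0 : ℝ) ×ˢ Set.Ioo (-a) a) := by
  rintro z ⟨hz1, hz2⟩ z' ⟨hz1', hz2'⟩ h
  have e1 := spheroidalCoord_sq ha (Set.Ioo_subset_Icc_self hz2)
  have e2 := spheroidalCoord_sq ha (Set.Ioo_subset_Icc_self hz2')
  have e3 : z.1 * z.2 = z'.1 * z'.2 := by
    have := congrArg Prod.snd h
    simp only [spheroidalCoord] at this
    field_simp at this
    exact this
  rw [h, e2] at e1
  have h4 : (⟨z.1, z.2⟩ : ℂ) = ⟨z'.1, z'.2⟩ := by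
    refine eq_of_sq_eq_of_re_pos hz1' (le_of_lt hz1) ?_
    apply Complex.ext
    · simp [pow_two]; linarith
    · simp [pow_two]; linarith
  exact Prod.ext (congrArg Complex.re h4) (congrArg Complex.im h4)

theorem exists_sq_eq_re_nonneg (w : ℂ) : ∃ z : ℂ, z ^ 2 = w ∧ 0 ≤ z.re := by
  obtain ⟨z, hz⟩ := IsAlgClosed.exists_pow_nat_eq w two_pos
  rcases le_total 0 z.re with h | h
  · exact ⟨z, hz, h⟩
  · exact ⟨-z, by rw [neg_sq, hz], by simpa using h⟩

/-- Take a root of `ρ² + ζ² - a² + 2iaζ` with nonnegative real part. If that part were zero, then `ζ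
= 0` and `ρ² - a² = -q² ≤ 0`, which puts the point on the focal disk. -/
theorem mem_image_spheroidalCoord {a : ℝ} (ha : 0 < a) {w : ℝ × ℝ} (hw : 0 < w.1)
    (hw' : w.2 = 0 → a < w.1) :
    w ∈ spheroidalCoord a '' (Set.Ioi (0 : ℝ) ×ˢ Set.Ioo (-a) a) := by
  obtain ⟨γ, hγ, hp⟩ := exists_sq_eq_re_nonneg ⟨w.1 ^ 2 + w.2 ^ 2 - a ^ 2, 2 * a * w.2⟩
  have h1 : γ.re ^ 2 - γ.im ^ 2 = w.1 ^ 2 + w.2 ^ 2 - a ^ 2 := by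
    have := congrArg Complex.re hγ
    simpa [pow_two] using this
  have h2 : γ.re * γ.im = a * w.2 := by
    have := congrArg Complex.im hγ
    simp [pow_two] at this
    linarith
  have hp0 : 0 < γ.re := by
    refine lt_of_le_of_ne hp fun h0 => ?_
    rw [← h0] at h1 h2
    have hz : w.2 = 0 := by
      rcases mul_eq_zero.mp (h2.symm.trans (zero_mul _)) with h | h
      · exact absurd h ha.ne'
      · exact h
    have := hw' hz
    rw [hz] at h1
    nlinarith [sq_nonneg γ.im]
  have h3 : (a ^ 2 + γ.re ^ 2) * (a ^ 2 - γ.im ^ 2) = (a * w.1) ^ 2 := by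
    linear_combination a ^ 2 * h1 - (γ.re * γ.im + a * w.2) * h2
  have h4 : 0 < a ^ 2 - γ.im ^ 2 := by
    have : 0 < (a ^ 2 + γ.re ^ 2) * (a ^ 2 - γ.im ^ 2) := by rw [h3]; positivity
    exact pos_of_mul_pos_right this (by positivity)
  refine ⟨(γ.re, γ.im), ⟨hp0, abs_lt.mp (abs_lt_of_sq_lt_sq (by linarith) ha.le)⟩, ?_⟩
  apply Prod.ext
  · simp only [spheroidalCoord]
    rw [← Real.sqrt_mul (by positivity), h3, Real.sqrt_sq (by positivity)]
    field_simp
  · simp only [spheroidalCoord]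
    rw [h2]; field_simp

/-- Change of variables from cylindrical to oblate spheroidal coordinates, for a function that
vanishes on the focal disk. -/
theorem integral_spheroidalCoord {a : ℝ} (ha : 0 < a) {g : ℝ × ℝ → ℂ}
    (hg : ∀ ρ, 0 < ρ → ρ ≤ a → g (ρ, 0) = 0) :
    ∫ w in Set.Ioi (0 : ℝ) ×ˢ (Set.univ : Set ℝ), g w =
      ∫ z in Set.Ioi (0 : ℝ) ×ˢ Set.Ioo (-a) a,
        ((z.1 ^ 2 + z.2 ^ 2) / (√(a ^ 2 + z.1 ^ 2) * √(a ^ 2 - z.2 ^ 2))) •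
          g (spheroidalCoord a z) := by
  have hmeas : MeasurableSet (Set.Ioi (0 : ℝ) ×ˢ Set.Ioo (-a) a) :=
    measurableSet_Ioi.prod measurableSet_Ioo
  have h1 := integral_image_eq_integral_abs_det_fderiv_smul volume hmeas
    (fun z hz => (hasFDerivAt_spheroidalCoord ha hz.2).hasFDerivWithinAt)
    (spheroidalCoord_injOn ha) g
  have h2 : ∫ z in Set.Ioi (0 : ℝ) ×ˢ Set.Ioo (-a) a,
      |(fderivSpheroidalCoord a z).det| • g (spheroidalCoord a z) =
      ∫ z in Set.Ioi (0 : ℝ) ×ˢ Set.Ioo (-a) a,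
        ((z.1 ^ 2 + z.2 ^ 2) / (√(a ^ 2 + z.1 ^ 2) * √(a ^ 2 - z.2 ^ 2))) •
          g (spheroidalCoord a z) := by
    refine setIntegral_congr_fun hmeas fun z hz => ?_
    rw [det_fderivSpheroidalCoord ha hz.2, abs_of_nonneg (by positivity)]
  rw [← h2, ← h1]
  -- The image misses only the segment `ζ = 0`, `0 < ρ ≤ a`, where `g` vanishes.
  refine setIntegral_eq_of_subset_of_forall_sdiff_eq_zero
    (measurableSet_Ioi.prod MeasurableSet.univ) ?_ ?_
  · rintro _ ⟨z, hz, rfl⟩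
    refine ⟨?_, Set.mem_univ _⟩
    have s2 : 0 < a ^ 2 - z.2 ^ 2 := by nlinarith [hz.2.1, hz.2.2]
    have : 0 < √(a ^ 2 + z.1 ^ 2) * √(a ^ 2 - z.2 ^ 2) / a := by positivity
    exact this
  · rintro w ⟨⟨hw, -⟩, hw'⟩
    by_contra hgw
    refine hw' (mem_image_spheroidalCoord ha hw fun h0 => ?_)
    by_contra hle
    apply hgw
    have : w = (w.1, 0) := Prod.ext rfl h0
    rw [this]
    exact hg _ hw (not_lt.mp hle)

end ComplexDistance

/-! ### Spheroidal coordinates in `ℝⁿ` and the spherical means. -/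

namespace ComplexDistance

variable {n : ℕ}

/-- The point with oblate spheroidal coordinates `p, q, σ`. -/
def spheroidalPoint (y : Space n) (p q : ℝ) (σ : Metric.sphere (0 : hyperplane y) 1) : Space n :=
  cylPoint y (√(‖y‖ ^ 2 + p ^ 2) * √(‖y‖ ^ 2 - q ^ 2) / ‖y‖) (p * q / ‖y‖) σ

/-- The derivative of `spheroidalPoint` with respect to `p`. -/
def spheroidalTangent (y : Space n) (p q : ℝ) (σ : Metric.sphere (0 : hyperplane y) 1) : Space n :=
  cylPoint y (p * √(‖y‖ ^ 2 - q ^ 2) / (‖y‖ * √(‖y‖ ^ 2 + p ^ 2))) (q / ‖y‖) σ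

/-- The mean of `∂ₚ f` over the sphere with spheroidal coordinates `p, q`. -/
def sharpMeanDeriv (y : Space n) (f : Space n → ℂ) (p q : ℝ) : ℂ :=
  ⨍ σ, fderiv ℝ f (spheroidalPoint y p q σ) (spheroidalTangent y p q σ) ∂(sphereMeasure y)

theorem sharpMean_eq (y : Space n) (f : Space n → ℂ) (p q : ℝ) :
    sharpMean y f p q = ⨍ σ, f (spheroidalPoint y p q σ) ∂(sphereMeasure y) := rfl

section Geometry

variable {y : Space n}

theorem continuous_spheroidalPoint {X : Type*} [TopologicalSpace X] {p q : X → ℝ}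
    {σ : X → Metric.sphere (0 : hyperplane y) 1} (hp : Continuous p) (hq : Continuous q)
    (hσ : Continuous σ) : Continuous fun t => spheroidalPoint y (p t) (q t) (σ t) := by
  unfold spheroidalPoint cylPoint
  fun_prop

theorem continuous_spheroidalTangent (hy : y ≠ 0) {X : Type*} [TopologicalSpace X] {p q : X → ℝ}
    {σ : X → Metric.sphere (0 : hyperplane y) 1} (hp : Continuous p) (hq : Continuous q)
    (hσ : Continuous σ) : Continuous fun t => spheroidalTangent y (p t) (q t) (σ t) := by
  have ha : 0 < ‖y‖ := norm_pos_iff.mpr hy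
  have h : ∀ t, ‖y‖ * √(‖y‖ ^ 2 + p t ^ 2) ≠ 0 := fun t => by positivity
  unfold spheroidalTangent cylPoint
  exact (((by fun_prop : Continuous fun t => p t * √(‖y‖ ^ 2 - q t ^ 2)).div
    (by fun_prop) h).smul (by fun_prop)).add (by fun_prop)

theorem hasDerivAt_spheroidalPoint (hy : y ≠ 0) (p q : ℝ)
    (σ : Metric.sphere (0 : hyperplane y) 1) :
    HasDerivAt (fun p => spheroidalPoint y p q σ) (spheroidalTangent y p q σ) p := by
  have ha : 0 < ‖y‖ := norm_pos_iff.mpr hy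
  have h1 : 0 < ‖y‖ ^ 2 + p ^ 2 := by positivity
  have d1 : HasDerivAt (fun p : ℝ => √(‖y‖ ^ 2 + p ^ 2) * √(‖y‖ ^ 2 - q ^ 2) / ‖y‖)
      (p * √(‖y‖ ^ 2 - q ^ 2) / (‖y‖ * √(‖y‖ ^ 2 + p ^ 2))) p := by
    have := (((((hasDerivAt_id p).pow 2).const_add (‖y‖ ^ 2)).sqrt h1.ne').mul_const
      (√(‖y‖ ^ 2 - q ^ 2))).div_const ‖y‖
    refine this.congr_deriv ?_
    simp
    field_simp
  have d2 : HasDerivAt (fun p : ℝ => p * q / ‖y‖) (q / ‖y‖) p := by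
    simpa using ((hasDerivAt_id p).mul_const q).div_const ‖y‖
  exact (d1.smul_const _).add (d2.smul_const _)

theorem complexLength_spheroidalPoint (hy : y ≠ 0) {p q : ℝ} (hp : 0 < p)
    (hq : q ∈ Set.Icc (-‖y‖) ‖y‖) (σ : Metric.sphere (0 : hyperplane y) 1) :
    complexLength (spheroidalPoint y p q σ) y = (p : ℂ) + Complex.I * (q : ℂ) := by
  have ha : 0 < ‖y‖ := norm_pos_iff.mpr hy
  apply complexLength_eq hp
  · have h := spheroidalCoord_sq ha (z := (p, q)) hq
    rw [spheroidalPoint, norm_cylPoint_sq hy]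
    exact h.symm
  · rw [spheroidalPoint, inner_cylPoint hy]
    field_simp

/-- The coordinates are orthogonal, so `∇p` is parallel to `∂ₚ`; as `dp(∂ₚ) = 1`, the factor is
`|∇p|²`. -/
theorem gradRe_spheroidalPoint (hy : y ≠ 0) {p q : ℝ} (hp : 0 < p)
    (hq : q ∈ Set.Icc (-‖y‖) ‖y‖) (σ : Metric.sphere (0 : hyperplane y) 1) :
    gradRe (spheroidalPoint y p q σ) y =
      ((‖y‖ ^ 2 + p ^ 2) / (p ^ 2 + q ^ 2)) • spheroidalTangent y p q σ := by
  have ha : 0 < ‖y‖ := norm_pos_iff.mpr hy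
  have h1 : 0 < ‖y‖ ^ 2 + p ^ 2 := by positivity
  have s1 : 0 < √(‖y‖ ^ 2 + p ^ 2) := Real.sqrt_pos.mpr h1
  have t1 := Real.sq_sqrt h1.le
  have hre : (complexLength (spheroidalPoint y p q σ) y).re = p := by
    rw [complexLength_spheroidalPoint hy hp hq]; simp
  have him : (complexLength (spheroidalPoint y p q σ) y).im = q := by
    rw [complexLength_spheroidalPoint hy hp hq]; simp
  rw [gradRe, hre, him, div_eq_inv_mul, mul_smul]
  congr 1
  simp only [spheroidalPoint, spheroidalTangent, cylPoint]
  match_scalars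
  · field_simp
    linear_combination √(‖y‖ ^ 2 - q ^ 2) * t1
  · field_simp
    ring

/-- Both terms carry `|∇p|² γ^{1-n}`. The minus sign of the second turns `2 - n` into `n - 2`, which
produces the bracket in `F♯`. -/
theorem smoothDensity_spheroidalPoint (hn : 3 ≤ n) (hy : y ≠ 0) (χ : ℝ → ℝ) (f : Space n → ℂ)
    {p q : ℝ} (hp : 0 < p) (hq : q ∈ Set.Icc (-‖y‖) ‖y‖)
    (σ : Metric.sphere (0 : hyperplane y) 1) :
    smoothDensity y χ f (spheroidalPoint y p q σ) =
      ((deriv χ p * ((‖y‖ ^ 2 + p ^ 2) / (p ^ 2 + q ^ 2)) : ℝ) : ℂ) *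
        ((f (spheroidalPoint y p q σ) + ((p : ℂ) + Complex.I * (q : ℂ)) *
          fderiv ℝ f (spheroidalPoint y p q σ) (spheroidalTangent y p q σ) / ((n : ℂ) - 2)) /
          ((p : ℂ) + Complex.I * (q : ℂ)) ^ (n - 1)) := by
  have hγ := complexLength_spheroidalPoint hy hp hq σ
  have hre : (complexLength (spheroidalPoint y p q σ) y).re = p := by rw [hγ]; simp
  have him : (complexLength (spheroidalPoint y p q σ) y).im = q := by rw [hγ]; simp
  have h0 : (p : ℂ) + Complex.I * (q : ℂ) ≠ 0 := by
    rw [← hγ]; exact complexLength_ne_zero (by rwa [hre])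
  obtain ⟨m, rfl⟩ : ∃ m, n = m + 2 := ⟨n - 2, by omega⟩
  have hm : (m : ℂ) ≠ 0 := by exact_mod_cast (by omega : m ≠ 0)
  rw [smoothDensity, complexForm_gradRe (by rwa [hre]), hre, him, hγ, gradRe_spheroidalPoint hy hp hq,
    map_smul, Complex.real_smul]
  set γ : ℂ := (p : ℂ) + Complex.I * (q : ℂ)
  have z1 : γ ^ (-((m + 2 : ℕ) : ℤ)) = (γ ^ (m + 2))⁻¹ := by rw [zpow_neg, zpow_natCast]
  have z2 : γ ^ (2 - ((m + 2 : ℕ) : ℤ)) = (γ ^ m)⁻¹ := by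
    rw [← zpow_natCast, ← zpow_neg]; congr 1; push_cast; ring
  have z3 : m + 2 - 1 = m + 1 := rfl
  rw [z1, z2, z3]
  have e1 : 2 - ((m + 2 : ℕ) : ℂ) = -m := by push_cast; ring
  have e2 : ((m + 2 : ℕ) : ℂ) - 2 = m := by push_cast; ring
  rw [e1, e2]
  push_cast
  generalize (((‖y‖ : ℂ) ^ 2 + (p : ℂ) ^ 2) / ((p : ℂ) ^ 2 + (q : ℂ) ^ 2)) = A
  field_simp
  ring

/-- The planar Jacobian, the weight `ρ^{n-2}` and `|∇p|²` are multiplied: `p² + q²` cancels and the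
Jacobian removes one power of `aρ`. -/
theorem jacobian_mul_pow (hn : 3 ≤ n) {a : ℝ} (ha : 0 < a) {p q : ℝ} (hp : 0 < p)
    (hq : q ∈ Set.Ioo (-a) a) :
    (p ^ 2 + q ^ 2) / (√(a ^ 2 + p ^ 2) * √(a ^ 2 - q ^ 2)) *
      ((√(a ^ 2 + p ^ 2) * √(a ^ 2 - q ^ 2) / a) ^ (n - 2) *
        ((a ^ 2 + p ^ 2) / (p ^ 2 + q ^ 2))) =
    (a ^ 2 + p ^ 2) ^ (((n : ℝ) - 3) / 2 + 1) / a ^ (n - 2) *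
      (a ^ 2 - q ^ 2) ^ (((n : ℝ) - 3) / 2) := by
  have h1 : 0 < a ^ 2 + p ^ 2 := by positivity
  have h2 : 0 < a ^ 2 - q ^ 2 := by nlinarith [hq.1, hq.2]
  have s1 : 0 < √(a ^ 2 + p ^ 2) := Real.sqrt_pos.mpr h1
  have s2 : 0 < √(a ^ 2 - q ^ 2) := Real.sqrt_pos.mpr h2
  obtain ⟨m, rfl⟩ : ∃ m, n = m + 3 := ⟨n - 3, by omega⟩
  have e : ∀ x : ℝ, 0 < x → x ^ ((((m + 3 : ℕ) : ℝ) - 3) / 2) = √x ^ m := by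
    intro x hx
    rw [Real.sqrt_eq_rpow, ← Real.rpow_natCast, ← Real.rpow_mul hx.le]
    congr 1; push_cast; ring
  rw [Real.rpow_add h1, Real.rpow_one, e _ h1, e _ h2, show m + 3 - 2 = m + 1 from rfl, div_pow]
  field_simp
  ring

end Geometry

section Mean

variable {y : Space n} {f : Space n → ℂ}

theorem continuous_sphereAverage {X : Type*} [TopologicalSpace X] [FirstCountableTopology X]
    [LocallyCompactSpace X] (y : Space n) {g : X → Metric.sphere (0 : hyperplane y) 1 → ℂ}
    (hg : Continuous (Function.uncurry g)) :
    Continuous fun t => ⨍ σ, g t σ ∂sphereMeasure y := by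
  simp_rw [average_eq]
  exact (continuous_integral_sphere y hg).const_smul _

theorem continuous_sharpMean (hf : Continuous f) :
    Continuous fun z : ℝ × ℝ => sharpMean y f z.1 z.2 :=
  continuous_sphereAverage y (g := fun (z : ℝ × ℝ) σ => f (spheroidalPoint y z.1 z.2 σ))
    (hf.comp (continuous_spheroidalPoint (by fun_prop) (by fun_prop) (by fun_prop)))

theorem continuous_fderiv_spheroidal (hy : y ≠ 0) (hf : ContDiff ℝ 1 f) {X : Type*}
    [TopologicalSpace X] {p q : X → ℝ} {σ : X → Metric.sphere (0 : hyperplane y) 1}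
    (hp : Continuous p) (hq : Continuous q) (hσ : Continuous σ) :
    Continuous fun t => fderiv ℝ f (spheroidalPoint y (p t) (q t) (σ t))
      (spheroidalTangent y (p t) (q t) (σ t)) :=
  ((hf.continuous_fderiv (by norm_num)).comp (continuous_spheroidalPoint hp hq hσ)).clm_apply
    (continuous_spheroidalTangent hy hp hq hσ)

theorem continuous_sharpMeanDeriv (hy : y ≠ 0) (hf : ContDiff ℝ 1 f) :
    Continuous fun z : ℝ × ℝ => sharpMeanDeriv y f z.1 z.2 :=
  continuous_sphereAverage y (g := fun (z : ℝ × ℝ) σ => fderiv ℝ f (spheroidalPoint y z.1 z.2 σ)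
    (spheroidalTangent y z.1 z.2 σ))
    (continuous_fderiv_spheroidal hy hf (by fun_prop) (by fun_prop) (by fun_prop))

theorem integrable_sphere {g : Metric.sphere (0 : hyperplane y) 1 → ℂ} (hg : Continuous g) :
    Integrable g (sphereMeasure y) :=
  hg.integrable_of_hasCompactSupport (HasCompactSupport.of_compactSpace g)

/-- Differentiation under the integral, dominated by compactness of the sphere. The endpoints `q =
±a` are harmless, since `√(a² - q²)` is constant in `p`. -/
theorem hasDerivAt_sharpMean (hy : y ≠ 0) (hf : ContDiff ℝ 1 f) (p q : ℝ) :
    HasDerivAt (fun p => sharpMean y f p q) (sharpMeanDeriv y f p q) p := by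
  simp only [sharpMean_eq, sharpMeanDeriv, average_eq]
  refine HasDerivAt.const_smul _ ?_
  have hc : Continuous (fun z : ℝ × Metric.sphere (0 : hyperplane y) 1 =>
      fderiv ℝ f (spheroidalPoint y z.1 q z.2) (spheroidalTangent y z.1 q z.2)) :=
    continuous_fderiv_spheroidal hy hf continuous_fst continuous_const continuous_snd
  obtain ⟨C, hC⟩ := ((isCompact_closedBall p 1).prod
    (isCompact_univ (X := Metric.sphere (0 : hyperplane y) 1))).exists_bound_of_continuousOn
      hc.continuousOn
  have hcf : ∀ p, Continuous fun σ => f (spheroidalPoint y p q σ) := fun p =>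
    hf.continuous.comp (continuous_spheroidalPoint continuous_const continuous_const continuous_id)
  have hcd : Continuous fun σ => fderiv ℝ f (spheroidalPoint y p q σ) (spheroidalTangent y p q σ) :=
    continuous_fderiv_spheroidal hy hf continuous_const continuous_const continuous_id
  have hbound : ∀ σ : Metric.sphere (0 : hyperplane y) 1, ∀ s ∈ Metric.ball p 1,
      ‖fderiv ℝ f (spheroidalPoint y s q σ) (spheroidalTangent y s q σ)‖ ≤ C := fun σ s hs =>
    hC (s, σ) ⟨Metric.ball_subset_closedBall hs, Set.mem_univ _⟩
  have hderiv : ∀ σ : Metric.sphere (0 : hyperplane y) 1, ∀ s ∈ Metric.ball p 1,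
      HasDerivAt (fun s => f (spheroidalPoint y s q σ))
        (fderiv ℝ f (spheroidalPoint y s q σ) (spheroidalTangent y s q σ)) s := fun σ s _ => by
    have h := (hf.differentiable (by norm_num) (spheroidalPoint y s q σ)).hasFDerivAt
    exact h.comp_hasDerivAt s (hasDerivAt_spheroidalPoint hy s q σ)
  exact (hasDerivAt_integral_of_dominated_loc_of_deriv_le (𝕜 := ℝ) (μ := sphereMeasure y)
    (bound := fun _ => C) (Metric.ball_mem_nhds p one_pos)
    (Filter.Eventually.of_forall fun p => (integrable_sphere (hcf p)).aestronglyMeasurable)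
    (integrable_sphere (hcf p)) (integrable_sphere hcd).aestronglyMeasurable
    (Filter.Eventually.of_forall hbound) (integrable_const C)
    (Filter.Eventually.of_forall hderiv)).2

theorem sourceDensity_sharpMean (hy : y ≠ 0) (hf : ContDiff ℝ 1 f) (a p q : ℝ) :
    sourceDensity n a (sharpMean y f) p q =
      (((a ^ 2 - q ^ 2) ^ (((n : ℝ) - 3) / 2) : ℝ) : ℂ) * (sharpMean y f p q +
        ((p : ℂ) + Complex.I * (q : ℂ)) * sharpMeanDeriv y f p q / ((n : ℂ) - 2)) := by
  rw [sourceDensity, (hasDerivAt_sharpMean hy hf p q).deriv]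

theorem ofReal_add_I_mul_ne_zero {p : ℝ} (hp : 0 < p) (q : ℝ) :
    (p : ℂ) + Complex.I * (q : ℂ) ≠ 0 := by
  intro h
  have := congrArg Complex.re h
  simp at this
  exact hp.ne' this

theorem continuous_sourceDensity (hn : 3 ≤ n) (hy : y ≠ 0) (hf : ContDiff ℝ 1 f) (a : ℝ) :
    Continuous fun z : ℝ × ℝ => sourceDensity n a (sharpMean y f) z.1 z.2 := by
  simp_rw [sourceDensity_sharpMean hy hf]
  -- The one use of `n ≥ 3` here: a nonnegative `ν` keeps `(a² - q²)^ν` continuous where its base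
  -- vanishes.
  have h3 : (0 : ℝ) ≤ ((n : ℝ) - 3) / 2 := by
    have : (3 : ℝ) ≤ n := by exact_mod_cast hn
    linarith
  have h1 : Continuous fun z : ℝ × ℝ => (a ^ 2 - z.2 ^ 2) ^ (((n : ℝ) - 3) / 2) :=
    (by fun_prop : Continuous fun z : ℝ × ℝ => a ^ 2 - z.2 ^ 2).rpow_const fun _ => Or.inr h3
  exact (Complex.continuous_ofReal.comp h1).mul ((continuous_sharpMean hf.continuous).add
    (((by fun_prop : Continuous fun z : ℝ × ℝ => (z.1 : ℂ) + Complex.I * (z.2 : ℂ)).mul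
      (continuous_sharpMeanDeriv hy hf)).div_const _))

theorem continuousOn_sourceDensity_div (hn : 3 ≤ n) (hy : y ≠ 0) (hf : ContDiff ℝ 1 f) (a : ℝ) :
    ContinuousOn (fun z : ℝ × ℝ => sourceDensity n a (sharpMean y f) z.1 z.2 /
      ((z.1 : ℂ) + Complex.I * (z.2 : ℂ)) ^ (n - 1)) (Set.Ioi 0 ×ˢ Set.univ) :=
  (continuous_sourceDensity hn hy hf a).continuousOn.div
    (by fun_prop : Continuous fun z : ℝ × ℝ =>
      ((z.1 : ℂ) + Complex.I * (z.2 : ℂ)) ^ (n - 1)).continuousOn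
    fun z hz => pow_ne_zero _ (ofReal_add_I_mul_ne_zero hz.1 z.2)

theorem intervalIntegrable_sourceDensity (hn : 3 ≤ n) (hy : y ≠ 0) (hf : ContDiff ℝ 1 f) (a : ℝ)
    {p : ℝ} (hp : 0 < p) (b c : ℝ) :
    IntervalIntegrable (fun q : ℝ => sourceDensity n a (sharpMean y f) p q /
      ((p : ℂ) + Complex.I * (q : ℂ)) ^ (n - 1)) volume b c :=
  ((continuousOn_sourceDensity_div hn hy hf a).comp_continuous
    (by fun_prop : Continuous fun q : ℝ => (p, q)) fun q => ⟨hp, Set.mem_univ _⟩).intervalIntegrable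
      _ _

/-- Replacing `t` by `|t|` keeps `p ≥ ε > 0`, so one-sided continuity at `ε` becomes continuity on
all of `ℝ`. -/
theorem continuous_sourceFunctional_add_abs (hn : 3 ≤ n) (hy : y ≠ 0) (hf : ContDiff ℝ 1 f)
    {a ε : ℝ} (ha : 0 < a) (hε : 0 < ε) :
    Continuous fun t : ℝ => sourceFunctional n a (ε + |t|) (sharpMean y f) := by
  unfold sourceFunctional
  refine Continuous.mul (Complex.continuous_ofReal.comp ?_) ?_
  · refine Continuous.div_const (Continuous.rpow_const (by fun_prop) fun t => Or.inl ?_) _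
    positivity
  · apply intervalIntegral.continuous_parametric_intervalIntegral_of_continuous'
    exact (continuousOn_sourceDensity_div hn hy hf a).comp_continuous
      (by fun_prop : Continuous fun z : ℝ × ℝ => (ε + |z.1|, z.2))
      fun z => ⟨by simp only [Set.mem_Ioi]; positivity, Set.mem_univ _⟩

end Mean

end ComplexDistance

/-! ### The smoothed source as a superposition of the functionals `I_p`. -/

namespace ComplexDistance

variable {n : ℕ} {y : Space n} {f : Space n → ℂ}

theorem sphereArea_pos (hn : 1 ≤ n) : 0 < sphereArea n := by
  have : (0 : ℝ) < n := by exact_mod_cast hn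
  have := Real.Gamma_pos_of_pos (s := (n : ℝ) / 2) (by positivity)
  unfold sphereArea
  positivity

theorem sphereMeasure_real_univ (hn : 3 ≤ n) (hy : y ≠ 0) :
    (sphereMeasure y).real Set.univ = sphereArea (n - 1) := by
  have hfr := finrank_hyperplane hy
  have : Nontrivial (hyperplane y) := Module.nontrivial_of_finrank_pos (R := ℝ) (by omega)
  obtain ⟨m, rfl⟩ : ∃ m, n = m + 2 := ⟨n - 2, by omega⟩
  have hm : (0 : ℝ) < (m + 1 : ℝ) / 2 := by positivity
  have hG := Real.Gamma_pos_of_pos hm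
  rw [sphereMeasure_eq, Measure.toSphere_real_apply_univ, hfr, measureReal_def,
    InnerProductSpace.volume_ball, hfr]
  rw [sphereArea, show m + 2 - 1 = m + 1 from rfl]
  push_cast
  rw [ENNReal.toReal_mul, ENNReal.toReal_pow, ENNReal.toReal_ofReal zero_le_one,
    ENNReal.toReal_ofReal (by rw [Real.Gamma_add_one hm.ne']; positivity),
    Real.Gamma_add_one hm.ne', ]
  have : π ^ (((m : ℝ) + 1) / 2) = √π ^ (m + 1) := by
    rw [Real.sqrt_eq_rpow, ← Real.rpow_natCast, ← Real.rpow_mul pi_pos.le]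
    congr 1; push_cast; ring
  rw [this, one_pow, one_mul]
  field_simp

/-- `γ` and `|∇p|²` do not depend on `σ`, so only `f` and `∂ₚf` are averaged. The factor `ω_{n-1}`
undoes the normalization of the mean. -/
theorem integral_sphere_smoothDensity (hn : 3 ≤ n) (hy : y ≠ 0) (hf : ContDiff ℝ 1 f)
    (χ : ℝ → ℝ) {p q : ℝ} (hp : 0 < p) (hq : q ∈ Set.Icc (-‖y‖) ‖y‖) :
    ∫ σ, smoothDensity y χ f (spheroidalPoint y p q σ) ∂sphereMeasure y =
      ((deriv χ p * ((‖y‖ ^ 2 + p ^ 2) / (p ^ 2 + q ^ 2)) * sphereArea (n - 1) : ℝ) : ℂ) *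
        ((sharpMean y f p q + ((p : ℂ) + Complex.I * (q : ℂ)) * sharpMeanDeriv y f p q /
          ((n : ℂ) - 2)) / ((p : ℂ) + Complex.I * (q : ℂ)) ^ (n - 1)) := by
  simp_rw [smoothDensity_spheroidalPoint hn hy χ f hp hq]
  have i1 : Integrable (fun σ => f (spheroidalPoint y p q σ)) (sphereMeasure y) :=
    integrable_sphere (hf.continuous.comp
      (continuous_spheroidalPoint continuous_const continuous_const continuous_id))
  have i2 : Integrable (fun σ => fderiv ℝ f (spheroidalPoint y p q σ)
      (spheroidalTangent y p q σ)) (sphereMeasure y) :=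
    integrable_sphere
      (continuous_fderiv_spheroidal hy hf continuous_const continuous_const continuous_id)
  rw [integral_const_mul, integral_div, integral_add i1 ((i2.const_mul _).div_const _),
    integral_div, integral_const_mul, sharpMean_eq, sharpMeanDeriv, average_eq, average_eq,
    sphereMeasure_real_univ hn hy]
  have hA : (sphereArea (n - 1) : ℂ) ≠ 0 := by
    exact_mod_cast (sphereArea_pos (by omega : 1 ≤ n - 1)).ne'
  simp only [Complex.real_smul]
  push_cast
  generalize ((p : ℂ) + Complex.I * (q : ℂ)) ^ (n - 1) = G
  generalize ((n : ℂ) - 2) = N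
  generalize (sphereArea (n - 1) : ℂ) = A at *
  field_simp

theorem integral_smoothDensity (hn : 3 ≤ n) (hy : y ≠ 0) (hf : ContDiff ℝ 2 f)
    (hf' : HasCompactSupport f) {ε R : ℝ} (hε : 0 < ε) {χ : ℝ → ℝ} (hχ : ContDiff ℝ 1 χ)
    (hχ0 : ∀ t ≤ ε, χ t = 0) (hχ1 : ∀ t, R < t → deriv χ t = 0) :
    ∫ x, smoothDensity y χ f x = ∫ p in Set.Ioi (0 : ℝ), ((deriv χ p : ℝ) : ℂ) *
      ((sphereArea n : ℂ) * sourceFunctional n ‖y‖ p (sharpMean y f)) := by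
  have ha : 0 < ‖y‖ := norm_pos_iff.mpr hy
  have hf1 : ContDiff ℝ 1 f := hf.of_le (by norm_num)
  have hd0 : ∀ t < ε, deriv χ t = 0 := by
    intro t ht
    have : χ =ᶠ[nhds t] fun _ => 0 := by
      filter_upwards [eventually_lt_nhds ht] with s hs using hχ0 s hs.le
    rw [this.deriv_eq]; simp
  have hmeas : MeasurableSet (Set.Ioi (0 : ℝ) ×ˢ Set.Ioo (-‖y‖) ‖y‖) :=
    measurableSet_Ioi.prod measurableSet_Ioo
  rw [integral_eq_integral_cylPoint hn hy (continuous_smoothDensity hε hχ hχ0 hn hf)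
    (hasCompactSupport_smoothDensity hf')]
  rw [integral_spheroidalCoord ha (g := fun z => z.1 ^ (n - 2) •
    ∫ σ, smoothDensity y χ f (cylPoint y z.1 z.2 σ) ∂sphereMeasure y)]
  swap
  · intro ρ hρ hρa
    -- On the focal disk `pq = 0` and `p² - q² ≤ 0` force `p = 0`, where `χ'` vanishes.
    have h0 : ∀ σ, smoothDensity y χ f (cylPoint y ρ 0 σ) = 0 := by
      intro σ
      have h1 := complexLength_sq_sub (cylPoint y ρ 0 σ) y
      have h2 := complexLength_re_mul_im (cylPoint y ρ 0 σ) y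
      rw [norm_cylPoint_sq hy] at h1
      rw [inner_cylPoint hy, mul_zero] at h2
      have h3 : (complexLength (cylPoint y ρ 0 σ) y).re = 0 := by
        rcases mul_eq_zero.mp h2 with h | h
        · exact h
        · rw [h] at h1
          have : (complexLength (cylPoint y ρ 0 σ) y).re ^ 2 ≤ 0 := by nlinarith
          exact pow_eq_zero_iff two_ne_zero |>.mp (le_antisymm this (sq_nonneg _))
      rw [smoothDensity, h3, hd0 0 hε]
      simp
    simp [h0]
  set Φ : ℝ × ℝ → ℂ := fun z => sourceDensity n ‖y‖ (sharpMean y f) z.1 z.2 /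
    ((z.1 : ℂ) + Complex.I * (z.2 : ℂ)) ^ (n - 1) with hΦ
  set c : ℝ → ℝ := fun p => (‖y‖ ^ 2 + p ^ 2) ^ (((n : ℝ) - 3) / 2 + 1) / ‖y‖ ^ (n - 2) *
    sphereArea (n - 1) with hc
  have e1 : ∀ z ∈ Set.Ioi (0 : ℝ) ×ˢ Set.Ioo (-‖y‖) ‖y‖,
      ((z.1 ^ 2 + z.2 ^ 2) / (√(‖y‖ ^ 2 + z.1 ^ 2) * √(‖y‖ ^ 2 - z.2 ^ 2))) •
        ((spheroidalCoord ‖y‖ z).1 ^ (n - 2) • ∫ σ, smoothDensity y χ f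
          (cylPoint y (spheroidalCoord ‖y‖ z).1 (spheroidalCoord ‖y‖ z).2 σ) ∂sphereMeasure y) =
      ((deriv χ z.1 * c z.1 : ℝ) : ℂ) * Φ z := by
    intro z hz
    have h := integral_sphere_smoothDensity hn hy hf1 χ hz.1 (Set.Ioo_subset_Icc_self hz.2)
    have hj := jacobian_mul_pow hn ha hz.1 hz.2
    have h' : ∫ σ, smoothDensity y χ f
          (cylPoint y (spheroidalCoord ‖y‖ z).1 (spheroidalCoord ‖y‖ z).2 σ) ∂sphereMeasure y =
        ∫ σ, smoothDensity y χ f (spheroidalPoint y z.1 z.2 σ) ∂sphereMeasure y := rfl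
    rw [h', h, hΦ]
    simp only [sourceDensity_sharpMean hy hf1, hc, spheroidalCoord, Complex.real_smul]
    have hj' : ∀ d s : ℝ, (z.1 ^ 2 + z.2 ^ 2) / (√(‖y‖ ^ 2 + z.1 ^ 2) * √(‖y‖ ^ 2 - z.2 ^ 2)) *
        ((√(‖y‖ ^ 2 + z.1 ^ 2) * √(‖y‖ ^ 2 - z.2 ^ 2) / ‖y‖) ^ (n - 2) *
          (d * ((‖y‖ ^ 2 + z.1 ^ 2) / (z.1 ^ 2 + z.2 ^ 2)) * s)) =
        (d * ((‖y‖ ^ 2 + z.1 ^ 2) ^ (((n : ℝ) - 3) / 2 + 1) / ‖y‖ ^ (n - 2) * s)) *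
          (‖y‖ ^ 2 - z.2 ^ 2) ^ (((n : ℝ) - 3) / 2) := by
      intro d s
      linear_combination (d * s) * hj
    rw [← mul_assoc, ← mul_assoc, ← Complex.ofReal_mul, ← Complex.ofReal_mul, mul_assoc (_ / _ : ℝ),
      hj', Complex.ofReal_mul]
    ring
  rw [setIntegral_congr_fun hmeas e1]
  -- `χ'` confines `p` to `[ε, R]`, a compact range away from the singularity of `γ^{1-n}`.
  have hint : IntegrableOn (fun z : ℝ × ℝ => ((deriv χ z.1 * c z.1 : ℝ) : ℂ) * Φ z)
      (Set.Ioi (0 : ℝ) ×ˢ Set.Ioo (-‖y‖) ‖y‖) := by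
    have hcont : ContinuousOn (fun z : ℝ × ℝ => ((deriv χ z.1 * c z.1 : ℝ) : ℂ) * Φ z)
        (Set.Icc ε R ×ˢ Set.Icc (-‖y‖) ‖y‖) := by
      refine ContinuousOn.mul (Continuous.continuousOn ?_)
        ((continuousOn_sourceDensity_div hn hy hf1 ‖y‖).mono ?_)
      · have h1 : Continuous (deriv χ) := hχ.continuous_deriv (by norm_num)
        have h2 : Continuous c := by
          refine Continuous.mul_const (Continuous.div_const
            (Continuous.rpow_const (by fun_prop) fun t => Or.inl ?_) _) _
          positivity
        exact Complex.continuous_ofReal.comp ((h1.mul h2).comp continuous_fst)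
      · exact Set.prod_mono (fun p hp => hε.trans_le hp.1) (Set.subset_univ _)
    refine (hcont.integrableOn_compact (isCompact_Icc.prod isCompact_Icc)).of_forall_sdiff_eq_zero
      hmeas ?_
    rintro z ⟨hz, hz'⟩
    have : deriv χ z.1 = 0 := by
      by_contra hne
      refine hz' ⟨⟨?_, ?_⟩, Set.Ioo_subset_Icc_self hz.2⟩
      · by_contra h; exact hne (hd0 _ (not_le.mp h))
      · by_contra h; exact hne (hχ1 _ (not_le.mp h))
    simp [this]
  rw [Measure.volume_eq_prod, setIntegral_prod _ hint]
  refine setIntegral_congr_fun measurableSet_Ioi fun p hp => ?_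
  change ∫ q in Set.Ioo (-‖y‖) ‖y‖, ((deriv χ p * c p : ℝ) : ℂ) * Φ (p, q) = _
  have hassoc : ∀ u v w x : ℂ, u * (v * (w * x)) = u * v * w * x := fun u v w x => by ring
  rw [integral_const_mul, sourceFunctional, intervalIntegral.integral_of_le (by linarith),
    integral_Ioc_eq_integral_Ioo, hassoc]
  congr 1
  have h1 := (sphereArea_pos (by omega : 1 ≤ n)).ne'
  have h2 := (sphereArea_pos (by omega : 1 ≤ n - 1)).ne'
  rw [← Complex.ofReal_mul, ← Complex.ofReal_mul]
  congr 1
  -- The constants agree because `ω_{n-1} = ω_n / A_n`.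
  simp only [hc, areaRatio]
  field_simp

end ComplexDistance

/-! ### Removing the cutoff. -/

namespace ComplexDistance

variable {n : ℕ} {y : Space n} {f : Space n → ℂ} {ε : ℝ}

/-- A smooth approximation of `t ↦ θ(t - ε)` with a transition on `[ε, ε + h]`. -/
def smoothStep (ε h t : ℝ) : ℝ :=
  smoothTransition ((t - ε) / h)

theorem contDiff_smoothStep (ε h : ℝ) : ContDiff ℝ 1 (smoothStep ε h) := by
  have h1 : ContDiff ℝ 1 (fun t : ℝ => (t - ε) / h) := (contDiff_id.sub contDiff_const).div_const _
  exact (smoothTransition.contDiff (n := 1)).comp h1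

theorem smoothStep_of_le {h : ℝ} (hh : 0 < h) {t : ℝ} (ht : t ≤ ε) : smoothStep ε h t = 0 :=
  smoothTransition.zero_of_nonpos (div_nonpos_of_nonpos_of_nonneg (by linarith) hh.le)

theorem smoothStep_of_ge {h : ℝ} (hh : 0 < h) {t : ℝ} (ht : ε + h ≤ t) : smoothStep ε h t = 1 :=
  smoothTransition.one_of_one_le ((one_le_div hh).mpr (by linarith))

theorem deriv_smoothStep (ε h t : ℝ) :
    deriv (smoothStep ε h) t = deriv smoothTransition ((t - ε) / h) * h⁻¹ := by
  have h1 : HasDerivAt (fun t : ℝ => (t - ε) / h) h⁻¹ t := by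
    simpa using ((hasDerivAt_id t).sub_const ε).div_const h
  have h2 := ((smoothTransition.contDiff (n := 1)).differentiable (by norm_num)
    ((t - ε) / h)).hasDerivAt
  exact (h2.comp t h1).deriv

theorem deriv_smoothStep_of_gt {h : ℝ} (hh : 0 < h) {t : ℝ} (ht : ε + h < t) :
    deriv (smoothStep ε h) t = 0 := by
  have : smoothStep ε h =ᶠ[nhds t] fun _ => 1 := by
    filter_upwards [eventually_gt_nhds ht] with s hs using smoothStep_of_ge hh hs.le
  rw [this.deriv_eq]; simp

theorem deriv_smoothStep_of_lt {h : ℝ} (hh : 0 < h) {t : ℝ} (ht : t < ε) :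
    deriv (smoothStep ε h) t = 0 := by
  have : smoothStep ε h =ᶠ[nhds t] fun _ => 0 := by
    filter_upwards [eventually_lt_nhds ht] with s hs using smoothStep_of_le hh hs.le
  rw [this.deriv_eq]; simp

/-- Substitute `p = ε + ht`. The absolute value changes nothing for `h > 0` and `t ∈ [0, 1]`, but
gives an expression that makes sense for every real `h`, so the limit is continuity at `h = 0`. -/
theorem integral_deriv_smoothStep_mul (hε : 0 < ε) {h : ℝ} (hh : 0 < h) (H : ℝ → ℂ) :
    ∫ p in Set.Ioi (0 : ℝ), ((deriv (smoothStep ε h) p : ℝ) : ℂ) * H p =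
      ∫ t in (0 : ℝ)..1, ((deriv smoothTransition t : ℝ) : ℂ) * H (ε + |h * t|) := by
  have h1 : ∫ p in Set.Ioi (0 : ℝ), ((deriv (smoothStep ε h) p : ℝ) : ℂ) * H p =
      ∫ p in Set.Icc ε (ε + h), ((deriv (smoothStep ε h) p : ℝ) : ℂ) * H p := by
    refine setIntegral_eq_of_subset_of_forall_sdiff_eq_zero measurableSet_Ioi
      (fun p hp => hε.trans_le hp.1) ?_
    rintro p ⟨-, hp⟩
    have : deriv (smoothStep ε h) p = 0 := by
      by_contra hne
      refine hp ⟨?_, ?_⟩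
      · by_contra hlt; exact hne (deriv_smoothStep_of_lt hh (not_le.mp hlt))
      · by_contra hlt; exact hne (deriv_smoothStep_of_gt hh (not_le.mp hlt))
    simp [this]
  rw [h1, integral_Icc_eq_integral_Ioc, ← intervalIntegral.integral_of_le (by linarith)]
  have h2 := intervalIntegral.integral_comp_mul_add (a := 0) (b := 1)
    (fun p => ((deriv (smoothStep ε h) p : ℝ) : ℂ) * H p) hh.ne' ε
  rw [mul_zero, mul_one, zero_add, add_comm h ε] at h2
  have h3 : ∫ p in ε..(ε + h), ((deriv (smoothStep ε h) p : ℝ) : ℂ) * H p =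
      h • ∫ t in (0 : ℝ)..1, ((deriv (smoothStep ε h) (h * t + ε) : ℝ) : ℂ) * H (h * t + ε) := by
    rw [h2, smul_smul, mul_inv_cancel₀ hh.ne', one_smul]
  rw [h3, ← intervalIntegral.integral_smul]
  refine intervalIntegral.integral_congr fun t ht => ?_
  rw [Set.uIcc_of_le zero_le_one] at ht
  rw [deriv_smoothStep, abs_of_nonneg (mul_nonneg hh.le ht.1), add_comm ε,
    show (h * t + ε - ε) / h = t by field_simp; ring, Complex.real_smul]
  have : (h : ℂ) ≠ 0 := by exact_mod_cast hh.ne'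
  push_cast
  field_simp

theorem tendsto_integral_deriv_smoothStep_mul (hε : 0 < ε) {H : ℝ → ℂ}
    (hH : Continuous fun t => H (ε + |t|)) :
    Filter.Tendsto (fun k : ℕ => ∫ p in Set.Ioi (0 : ℝ),
      ((deriv (smoothStep ε (1 / ((k : ℝ) + 1))) p : ℝ) : ℂ) * H p) Filter.atTop (nhds (H ε)) := by
  have hs : ContDiff ℝ 1 smoothTransition := smoothTransition.contDiff (n := 1)
  have hs' : Continuous (deriv smoothTransition) := hs.continuous_deriv (by norm_num)
  have hc : Continuous fun h : ℝ => ∫ t in (0 : ℝ)..1,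
      ((deriv smoothTransition t : ℝ) : ℂ) * H (ε + |h * t|) := by
    apply intervalIntegral.continuous_parametric_intervalIntegral_of_continuous'
    exact (Complex.continuous_ofReal.comp (hs'.comp continuous_snd)).mul
      (hH.comp (by fun_prop : Continuous fun z : ℝ × ℝ => z.1 * z.2))
  have h0 : ∫ t in (0 : ℝ)..1, ((deriv smoothTransition t : ℝ) : ℂ) * H (ε + |0 * t|) = H ε := by
    simp only [zero_mul, abs_zero, add_zero]
    rw [intervalIntegral.integral_mul_const, intervalIntegral.integral_ofReal,
      intervalIntegral.integral_deriv_eq_sub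
        (fun t _ => hs.differentiable (by norm_num) t) (hs'.intervalIntegrable _ _)]
    simp
  have h1 := (hc.tendsto 0).comp tendsto_one_div_add_atTop_nhds_zero_nat
  rw [h0] at h1
  refine h1.congr fun k => ?_
  rw [Function.comp_apply, integral_deriv_smoothStep_mul hε (by positivity)]

theorem norm_complexLength_zpow_le (hn : 3 ≤ n) (hε : 0 < ε) {x : Space n}
    (hx : ε ≤ (complexLength x y).re) :
    ‖complexLength x y ^ (2 - (n : ℤ)) / (2 - (n : ℂ))‖ ≤ (ε ^ (n - 2))⁻¹ * ‖(2 - (n : ℂ))⁻¹‖ := by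
  have h1 : ε ≤ ‖complexLength x y‖ := hx.trans (Complex.re_le_norm _)
  have h2 : complexLength x y ^ (2 - (n : ℤ)) = (complexLength x y ^ (n - 2))⁻¹ := by
    rw [← zpow_natCast, ← zpow_neg]; congr 1; omega
  rw [h2, div_eq_mul_inv, norm_mul, norm_inv, norm_pow]
  gcongr

theorem norm_cutoffPotential_le (hn : 3 ≤ n) (hε : 0 < ε) {h : ℝ} (hh : 0 < h) (x : Space n) :
    ‖cutoffPotential y (smoothStep ε h) x‖ ≤ (ε ^ (n - 2))⁻¹ * ‖(2 - (n : ℂ))⁻¹‖ := by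
  rw [cutoffPotential, norm_mul]
  rcases le_total (complexLength x y).re ε with hx | hx
  · rw [smoothStep_of_le hh hx]
    simp only [Complex.ofReal_zero, norm_zero, zero_mul]
    positivity
  · have h1 : ‖(smoothStep ε h (complexLength x y).re : ℂ)‖ ≤ 1 := by
      rw [Complex.norm_real, smoothStep, Real.norm_of_nonneg (smoothTransition.nonneg _)]
      exact smoothTransition.le_one _
    calc _ ≤ 1 * ‖complexLength x y ^ (2 - (n : ℤ)) / (2 - (n : ℂ))‖ := by gcongr
      _ ≤ _ := by rw [one_mul]; exact norm_complexLength_zpow_le hn hε hx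

/-- At each point the sequence is eventually constant. On `p = ε` both sides are zero, since the
transition starts at `ε` and `heaviside 0 = 0`. -/
theorem tendsto_cutoffPotential (y : Space n) (ε : ℝ) (x : Space n) :
    Filter.Tendsto (fun k : ℕ => (1 / (sphereArea n : ℂ)) *
      cutoffPotential y (smoothStep ε (1 / ((k : ℝ) + 1))) x)
      Filter.atTop (nhds (regPotential y ε x)) := by
  apply tendsto_const_nhds.congr'
  rcases le_or_gt (complexLength x y).re ε with hx | hx
  · refine Filter.Eventually.of_forall fun k => ?_
    have : ¬ 0 < (complexLength x y).re - ε := by linarith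
    change regPotential y ε x = _ * cutoffPotential _ _ _
    rw [cutoffPotential, smoothStep_of_le (by positivity) hx, regPotential, heaviside, if_neg this]
    simp
  · have h1 := tendsto_one_div_add_atTop_nhds_zero_nat (𝕜 := ℝ)
    have h2 : 0 < (complexLength x y).re - ε := by linarith
    filter_upwards [h1.eventually_lt_const h2] with k hk
    rw [cutoffPotential, smoothStep_of_ge (by positivity) (by linarith), regPotential, heaviside,
      if_pos h2, potential]
    simp

theorem contDiff_cutoffPotential_smoothStep (hε : 0 < ε) {h : ℝ} (hh : 0 < h) :
    ContDiff ℝ 1 (cutoffPotential y (smoothStep ε h)) :=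
  contDiff_cutoffPotential (m := 1) hε (contDiff_smoothStep ε h) fun _ ht => smoothStep_of_le hh ht

/-- Measurability and boundedness both pass to the pointwise limit of the continuous cutoff
potentials. -/
theorem locallyIntegrable_regPotential (hn : 3 ≤ n) (y : Space n) (hε : 0 < ε) :
    LocallyIntegrable (regPotential y ε) := by
  have hm : StronglyMeasurable (regPotential y ε) := by
    refine stronglyMeasurable_of_tendsto (f := fun (k : ℕ) x => (1 / (sphereArea n : ℂ)) *
      cutoffPotential y (smoothStep ε (1 / ((k : ℝ) + 1))) x) Filter.atTop (fun k => ?_) ?_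
    · exact (continuous_const.mul
        (contDiff_cutoffPotential_smoothStep hε (by positivity)).continuous).stronglyMeasurable
    · exact tendsto_pi_nhds.mpr fun x => tendsto_cutoffPotential y ε x
  refine (locallyIntegrable_const (‖1 / (sphereArea n : ℂ)‖ *
    ((ε ^ (n - 2))⁻¹ * ‖(2 - (n : ℂ))⁻¹‖))).mono hm.aestronglyMeasurable
    (Filter.Eventually.of_forall fun x => ?_)
  refine le_trans ?_ (le_abs_self _)
  refine le_of_tendsto (tendsto_cutoffPotential y ε x).norm (Filter.Eventually.of_forall fun k => ?_)
  rw [norm_mul]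
  gcongr
  exact norm_cutoffPotential_le hn hε (by positivity) x

/-- The Laplacian as a sum of iterated directional derivatives. -/
def coordLaplacian (f : Space n → ℂ) (x : Space n) : ℂ :=
  ∑ i, fderiv ℝ (fun x => fderiv ℝ f x (EuclideanSpace.basisFun (Fin n) ℝ i)) x
    (EuclideanSpace.basisFun (Fin n) ℝ i)

theorem continuous_coordLaplacian (hf : ContDiff ℝ 2 f) : Continuous (coordLaplacian f) := by
  refine continuous_finsetSum _ fun i _ => ?_
  have h1 : ContDiff ℝ 1 (fun x => fderiv ℝ f x (EuclideanSpace.basisFun (Fin n) ℝ i)) :=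
    (hf.fderiv_right (m := 1) (by norm_num)).clm_apply contDiff_const
  exact (h1.continuous_fderiv (by norm_num)).clm_apply continuous_const

theorem hasCompactSupport_coordLaplacian (hf : HasCompactSupport f) :
    HasCompactSupport (coordLaplacian f) := by
  refine hf.mono' fun x hx => ?_
  by_contra hx'
  apply hx
  refine Finset.sum_eq_zero fun i _ => ?_
  have h : x ∉ tsupport (fun x => fderiv ℝ f x (EuclideanSpace.basisFun (Fin n) ℝ i)) := fun hmem =>
    hx' (tsupport_fderiv_apply_subset ℝ _ hmem)
  rw [fderiv_of_notMem_tsupport ℝ h]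
  simp

theorem integral_regPotential_mul_coordLaplacian (hn : 3 ≤ n) (hy : y ≠ 0) (hε : 0 < ε)
    (hf : ContDiff ℝ 2 f) (hf' : HasCompactSupport f) :
    ∫ x, regPotential y ε x * coordLaplacian f x =
      sourceFunctional n ‖y‖ ε (sharpMean y f) := by
  have hω : (sphereArea n : ℂ) ≠ 0 := by exact_mod_cast (sphereArea_pos (by omega : 1 ≤ n)).ne'
  have hL := continuous_coordLaplacian hf
  have hLi : Integrable (coordLaplacian f) :=
    hL.integrable_of_hasCompactSupport (hasCompactSupport_coordLaplacian hf')
  have t1 : Filter.Tendsto (fun k : ℕ => ∫ x, (1 / (sphereArea n : ℂ)) *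
      cutoffPotential y (smoothStep ε (1 / ((k : ℝ) + 1))) x * coordLaplacian f x)
      Filter.atTop (nhds (∫ x, regPotential y ε x * coordLaplacian f x)) := by
    refine tendsto_integral_of_dominated_convergence
      (fun x => ‖1 / (sphereArea n : ℂ)‖ * ((ε ^ (n - 2))⁻¹ * ‖(2 - (n : ℂ))⁻¹‖) *
        ‖coordLaplacian f x‖) (fun k => ?_) (hLi.norm.const_mul _) (fun k => ?_) ?_
    · exact ((continuous_const.mul (contDiff_cutoffPotential_smoothStep hε
        (by positivity)).continuous).mul hL).aestronglyMeasurable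
    · refine Filter.Eventually.of_forall fun x => ?_
      rw [norm_mul, norm_mul]
      gcongr
      exact norm_cutoffPotential_le hn hε (by positivity) x
    · exact Filter.Eventually.of_forall fun x =>
        (tendsto_cutoffPotential y ε x).mul tendsto_const_nhds
  have t2 : Filter.Tendsto (fun k : ℕ => ∫ x, (1 / (sphereArea n : ℂ)) *
      cutoffPotential y (smoothStep ε (1 / ((k : ℝ) + 1))) x * coordLaplacian f x)
      Filter.atTop (nhds ((1 / (sphereArea n : ℂ)) *
        ((sphereArea n : ℂ) * sourceFunctional n ‖y‖ ε (sharpMean y f)))) := by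
    have h := (tendsto_integral_deriv_smoothStep_mul hε
      (H := fun p => (sphereArea n : ℂ) * sourceFunctional n ‖y‖ p (sharpMean y f))
      (continuous_const.mul (continuous_sourceFunctional_add_abs hn hy (hf.of_le (by norm_num))
        (norm_pos_iff.mpr hy) hε))).const_mul (1 / (sphereArea n : ℂ))
    refine h.congr fun k => ?_
    have hk : (0 : ℝ) < 1 / ((k : ℝ) + 1) := by positivity
    rw [← integral_smoothDensity hn hy hf hf' hε (contDiff_smoothStep ε _)
      (fun _ ht => smoothStep_of_le hk ht) (R := ε + 1 / ((k : ℝ) + 1))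
      (fun _ ht => deriv_smoothStep_of_gt hk ht),
      ← integral_cutoffPotential_mul_laplacian hn hε (contDiff_smoothStep ε _)
      (fun _ ht => smoothStep_of_le hk ht) hf hf', ← integral_const_mul]
    simp only [mul_assoc, coordLaplacian]
  -- One sequence, two limits: dominated convergence for the potential, concentration of `χ'` for
  -- the source.
  rw [tendsto_nhds_unique t1 t2, ← mul_assoc, one_div_mul_cancel hω, one_mul]

end ComplexDistance

/-! ### The distribution `δ̃_ε` and its support. -/

namespace ComplexDistance

variable {n : ℕ} {y : Space n} {ε : ℝ}

theorem lineDeriv_lineDerivCLM (f : 𝓓^{2}((⊤ : TopologicalSpace.Opens (Space n)), ℂ))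
    (v x : Space n) :
    (TestFunction.lineDerivCLM ℂ v (TestFunction.lineDerivCLM ℂ v f :
      𝓓^{1}((⊤ : TopologicalSpace.Opens (Space n)), ℂ)) :
        𝓓^{0}((⊤ : TopologicalSpace.Opens (Space n)), ℂ)) x =
      fderiv ℝ (fun x => fderiv ℝ f x v) x v := by
  have hf : ContDiff ℝ 2 f := f.contDiff
  have h1 : ContDiff ℝ 1 (fun x => fderiv ℝ f x v) :=
    (hf.fderiv_right (m := 1) (by norm_num)).clm_apply contDiff_const
  have h2 : ((TestFunction.lineDerivCLM ℂ v f :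
      𝓓^{1}((⊤ : TopologicalSpace.Opens (Space n)), ℂ)) : Space n → ℂ) =
      fun x => fderiv ℝ f x v := by
    funext x
    rw [TestFunction.lineDerivCLM_apply_of_le (by norm_num),
      (hf.differentiable (by norm_num) x).lineDeriv_eq_fderiv]
  rw [TestFunction.lineDerivCLM_apply_of_le (by norm_num), h2,
    (h1.differentiable (by norm_num) x).lineDeriv_eq_fderiv]

theorem regSource_apply (hn : 3 ≤ n) (hε : 0 < ε)
    (f : 𝓓^{2}((⊤ : TopologicalSpace.Opens (Space n)), ℂ)) :
    regSource y ε f = ∫ x, regPotential y ε x * coordLaplacian f x := by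
  rw [regSource, distLaplacian, ContinuousLinearMap.comp_apply, functionDistribution,
    TestFunction.integralAgainstBilinCLM_eq_integral
      ((locallyIntegrable_regPotential hn y hε).locallyIntegrableOn _)]
  congr 1
  funext x
  rw [ContinuousLinearMap.mul_apply', mul_comm, sum_apply, sum_apply]
  simp only [ContinuousLinearMap.comp_apply, lineDeriv_lineDerivCLM, coordLaplacian]

theorem spheroidalPoint_mem_spheroid (hy : y ≠ 0) (hε : 0 < ε) {q : ℝ}
    (hq : q ∈ Set.Icc (-‖y‖) ‖y‖) (σ : Metric.sphere (0 : hyperplane y) 1) :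
    spheroidalPoint y ε q σ ∈ spheroid y ε := by
  change (complexLength _ y).re = ε
  rw [complexLength_spheroidalPoint hy hε hq]
  simp

theorem isClosed_spheroid (y : Space n) (ε : ℝ) : IsClosed (spheroid y ε) :=
  isClosed_eq (continuous_complexLength_re y) continuous_const

/-- Both means sample `f` and its derivative only at spheroidal points with `p = ε`, all of which
lie on `E_ε`. -/
theorem sourceFunctional_eq_zero (hy : y ≠ 0) (hε : 0 < ε) {f : Space n → ℂ} (hf : ContDiff ℝ 1 f)
    (hs : tsupport f ⊆ (spheroid y ε)ᶜ) : sourceFunctional n ‖y‖ ε (sharpMean y f) = 0 := by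
  have hnot : ∀ q ∈ Set.Icc (-‖y‖) ‖y‖, ∀ σ, spheroidalPoint y ε q σ ∉ tsupport f :=
    fun q hq σ hmem => hs hmem (spheroidalPoint_mem_spheroid hy hε hq σ)
  rw [sourceFunctional, intervalIntegral.integral_congr (g := fun _ => 0)]
  · simp
  · intro q hq
    rw [Set.uIcc_of_le (by linarith [norm_nonneg y])] at hq
    have h1 : ∀ σ, f (spheroidalPoint y ε q σ) = 0 := fun σ =>
      image_eq_zero_of_notMem_tsupport (hnot q hq σ)
    have h2 : ∀ σ, fderiv ℝ f (spheroidalPoint y ε q σ) = 0 := fun σ =>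
      fderiv_of_notMem_tsupport ℝ (hnot q hq σ)
    simp [sourceDensity_sharpMean hy hf, sharpMean_eq, sharpMeanDeriv, h1, h2]

end ComplexDistance

end

theorem proposition2 (n : ℕ) (hn : 3 ≤ n) (y : ComplexDistance.Space n) (hy : y ≠ 0)
    (ε : ℝ) (hε : 0 < ε) :
    -- `E_ε` is the oblate spheroid `ρ² / (a² + ε²) + ζ² / ε² = 1`
    ComplexDistance.spheroid y ε =
        {x | (‖x‖ ^ 2 - (⟪x, y⟫_ℝ / ‖y‖) ^ 2) / (‖y‖ ^ 2 + ε ^ 2)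
          + (⟪x, y⟫_ℝ / ‖y‖) ^ 2 / ε ^ 2 = 1} ∧
    -- `δ̃_ε` is supported on `E_ε`
    Distribution.dsupport (ComplexDistance.regSource y ε) ⊆ ComplexDistance.spheroid y ε ∧
    ∀ f : 𝓓^{2}((⊤ : TopologicalSpace.Opens (ComplexDistance.Space n)), ℂ),
      -- the derivative and the integral in `I_ε(f̄♯)` exist
      (∀ q ∈ Set.Icc (-‖y‖) ‖y‖,
        DifferentiableAt ℝ (fun p : ℝ => ComplexDistance.sharpMean y f p q) ε) ∧
      IntervalIntegrable
        (fun q : ℝ => ComplexDistance.sourceDensity n ‖y‖ (ComplexDistance.sharpMean y f) ε q /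
          ((ε : ℂ) + Complex.I * (q : ℂ)) ^ (n - 1)) volume (-‖y‖) ‖y‖ ∧
      -- `⟨δ̃_ε, f⟩ = I_ε(f̄♯)`
      ComplexDistance.regSource y ε f =
        ComplexDistance.sourceFunctional n ‖y‖ ε (ComplexDistance.sharpMean y f) := by
  have hformula : ∀ f : 𝓓^{2}((⊤ : TopologicalSpace.Opens (ComplexDistance.Space n)), ℂ),
      ComplexDistance.regSource y ε f =
        ComplexDistance.sourceFunctional n ‖y‖ ε (ComplexDistance.sharpMean y f) := fun f => by
    rw [ComplexDistance.regSource_apply hn hε]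
    exact ComplexDistance.integral_regPotential_mul_coordLaplacian hn hy hε f.contDiff
      f.hasCompactSupport
  have hf1 : ∀ f : 𝓓^{2}((⊤ : TopologicalSpace.Opens (ComplexDistance.Space n)), ℂ),
      ContDiff ℝ 1 f := fun f => ContDiff.of_le (n := 2) f.contDiff (by norm_num)
  refine ⟨ComplexDistance.spheroid_eq hy hε, ?_, fun f => ⟨fun q _ => ?_, ?_, hformula f⟩⟩
  · refine Set.sInter_subset_of_mem ⟨fun f hf => ?_, ComplexDistance.isClosed_spheroid y ε⟩
    rw [hformula]
    exact ComplexDistance.sourceFunctional_eq_zero hy hε (hf1 f) hf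
  · exact (ComplexDistance.hasDerivAt_sharpMean hy (hf1 f) ε q).differentiableAt
  · exact ComplexDistance.intervalIntegrable_sourceDensity hn hy (hf1 f) ‖y‖ hε _ _
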